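/- Let $0<q<1$, $\mathbb{R}_q^+=\{q^n : n\in\mathbb{Z}\}$, and let $V:\mathbb{R}_q^+\to\mathbb{R}$ (the potential) and $\alpha\in\mathbb{R}$ be given. For $f:\mathbb{R}_q^+\to\mathbb{C}$ put $$\Delta_q f(x)=\frac1{x^2}\Big[f(q^{-1}x)-\frac{1+q}{q}f(x)+\frac1q f(qx)\Big],\qquad Lf=Vf-\Delta_q f,\qquad D_qf(x)=\frac{f(x)-f(qx)}{(1-q)x},$$ $$\int_0^\infty f(x)\,d_qx=(1-q)\sum_{n\in\mathbb{Z}}q^nf(q^n),\qquad W_x(F,G)=\frac{(1-q)^2}{q}\big[F(x)\,D_qG(q^{-1}x)-G(x)\,D_qF(q^{-1}x)\big],$$ and let $L^2(\mathbb{R}_q^+)$ be the space of $f$ with $\int_0^\infty|f(x)|^2d_qx<\infty$. Write $f(0)=\lim f(x)$ and $f'(0)=\lim (f(x)-f(0))/x$ for the limits as $x\to0$ in $\mathbb{R}_q^+$. Suppose that for every $\lambda\in\mathbb{C}$ the equation $\Delta_qf(x)+[\lambda-V(x)]f(x)=0$ on $\mathbb{R}_q^+$ has solutions $\varphi(\cdot,\lambda)$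 and $\theta(\cdot,\lambda)$ with $$\varphi(0)=\tfrac{\sqrt q}{1-q}\sin\alpha,\quad \varphi'(0)=-\tfrac{\sqrt q}{1-q}\cos\alpha,\quad \theta(0)=\tfrac{\sqrt q}{1-q}\cos\alpha,\quad \theta'(0)=\tfrac{\sqrt q}{1-q}\sin\alpha .$$ For non-real $\lambda$ and $b\in\mathbb{R}_q^+$ let $C_b(\lambda)$ be the circle of all $l\in\mathbb{C}$ such that $u=\theta(\cdot,\lambda)+l\varphi(\cdot,\lambda)$ satisfies $u(b)\cos\beta+D_qu(q^{-1}b)\sin\beta=0$ for some real $\beta$; as $b\to\infty$ these nested circles converge to a limit-point or a limit-circle. Let $m$ be a function that is analytic on $\mathbb{C}$ except for poles at the distinct real points $\lambda_0,\lambda_1,\dots$, with residues $r_0,r_1,\dots$, such that for every non-real $\lambda$ the value $m(\lambda)$ is the limit-point, or a point on the limit-circle, of the circles $C_b(\lambda)$. Put $$\psi(x,\lambda)=\theta(x,\lambda)+m(\lambda)\varphi(x,\lambda),\qquad \psi_n(x)=\sqrt{r_n}\,\varphi(x,\lambda_n).$$ Let $\mathcal{L}_{q,2}$ be the space of all $f\in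 L^2(\mathbb{R}_q^+)$ such that $Lf\in L^2(\mathbb{R}_q^+)$, $f(0)$ and $f'(0)$ exist with $f(0)\cos\alpha+f'(0)\sin\alpha=0$, and $\lim_{x\to\infty}W_x(\psi(\cdot,\lambda),f)=0$ for every non-real $\lambda$. Theorem. For every $f\in\mathcal{L}_{q,2}$ the integrals $c_n=\int_0^\infty\psi_n(y)f(y)\,d_qy$ converge absolutely, and $$f(x)=\sum_{n=0}^\infty c_n\psi_n(x)\qquad\text{for all }x\in\mathbb{R}_q^+,$$ where the series converges absolutely for every $x\in\mathbb{R}_q^+$ and uniformly on $\mathbb{R}_q^+$. -/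

import Mathlib

open Filter Topology

noncomputable section

namespace QSturm

/-- The lattice `ℝ_q^+ = {q^n : n ∈ ℤ}`. Functions on it are represented by functions `ℝ → ℂ`;
only their values on the lattice are ever used. -/
def lattice (q : ℝ) : Set ℝ := Set.range fun n : ℤ => q ^ n

/-- The `q`-Laplace operator
`Δ_q f(x) = x⁻² (f(q⁻¹ x) - ((1 + q) / q) f(x) + (1 / q) f(q x))`. -/
def qLaplace (q : ℝ) (f : ℝ → ℂ) (x : ℝ) : ℂ :=
  1 / (x : ℂ) ^ 2 * (f (q⁻¹ * x) - (1 + (q : ℂ)) / (q : ℂ) * f x + 1 / (q : ℂ) * f (q * x))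

/-- The `q`-derivative `D_q f(x) = (f(x) - f(q x)) / ((1 - q) x)`, for `x ≠ 0`. -/
def qDeriv (q : ℝ) (f : ℝ → ℂ) (x : ℝ) : ℂ :=
  (f x - f (q * x)) / ((1 - (q : ℂ)) * (x : ℂ))

/-- `Λ_q⁻¹ D_q f(x) = (D_q f)(q⁻¹ x)`. -/
def qDerivBack (q : ℝ) (f : ℝ → ℂ) (x : ℝ) : ℂ := qDeriv q f (q⁻¹ * x)

/-- The `q`-Schrödinger operator `L f = V f - Δ_q f`, with potential `V`. -/
def qSchrodinger (q : ℝ) (V : ℝ → ℝ) (f : ℝ → ℂ) (x : ℝ) : ℂ :=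
  (V x : ℂ) * f x - qLaplace q f x

/-- Jackson's integral `∫_0^∞ f(x) d_q x = (1 - q) ∑_{n ∈ ℤ} q^n f(q^n)`. -/
def jackson (q : ℝ) (f : ℝ → ℂ) : ℂ :=
  (1 - (q : ℂ)) * ∑' n : ℤ, (q : ℂ) ^ n * f (q ^ n)

/-- Absolute convergence of Jackson's integral `∫_0^∞ f(x) d_q x`. -/
def JacksonIntegrable (q : ℝ) (f : ℝ → ℂ) : Prop :=
  Summable fun n : ℤ => q ^ n * ‖f (q ^ n)‖

/-- `f ∈ L²(ℝ_q^+)`, that is, `∫_0^∞ |f(x)|² d_q x < ∞`. -/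
def MemL2 (q : ℝ) (f : ℝ → ℂ) : Prop :=
  Summable fun n : ℤ => q ^ n * ‖f (q ^ n)‖ ^ 2

/-- The `q`-Wronskian
`W_x(F, G) = ((1 - q)² / q) (F(x) Λ_q⁻¹ D_q G(x) - G(x) Λ_q⁻¹ D_q F(x))`. -/
def wronskian (q : ℝ) (F G : ℝ → ℂ) (x : ℝ) : ℂ :=
  (1 - (q : ℂ)) ^ 2 / (q : ℂ) * (F x * qDerivBack q G x - G x * qDerivBack q F x)

/-- `f(0) = a` and `f'(0) = b`, where `f(0)` and `f'(0)` are the limits of `f(x)` and of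
`(f(x) - f(0)) / x` as `x → 0` in `ℝ_q^+`, that is, along `x = q^k`, `k → ∞`. -/
def HasValuesAtZero (q : ℝ) (f : ℝ → ℂ) (a b : ℂ) : Prop :=
  Tendsto (fun k : ℕ => f (q ^ k)) atTop (𝓝 a) ∧
  Tendsto (fun k : ℕ => (f (q ^ k) - a) / (q : ℂ) ^ k) atTop (𝓝 b)

/-- `f` solves `Δ_q f(x) + (lam - V(x)) f(x) = 0` on `ℝ_q^+`. -/
def IsSolution (q : ℝ) (V : ℝ → ℝ) (lam : ℂ) (f : ℝ → ℂ) : Prop :=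
  ∀ x ∈ lattice q, qLaplace q f x + (lam - (V x : ℂ)) * f x = 0

/-- The circle `C_b`: all `l` for which `θ + l φ` satisfies some real boundary condition
`(θ + l φ)(b) cos β + Λ_q⁻¹ D_q (θ + l φ)(b) sin β = 0` at `b`. -/
def weylCircle (q : ℝ) (θ φ : ℝ → ℂ) (b : ℝ) : Set ℂ :=
  {l | ∃ β : ℝ, (θ b + l * φ b) * (Real.cos β : ℂ) +
    (qDerivBack q θ b + l * qDerivBack q φ b) * (Real.sin β : ℂ) = 0}

/-- The limit of the circles `C_b` as `b → ∞` in `ℝ_q^+` (along `b = q^(-k)`, `k → ∞`): the points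
that are limits of points `l_b ∈ C_b`. The circles are nested, so this is the limit-point or the
limit-circle. -/
def weylLimit (q : ℝ) (θ φ : ℝ → ℂ) : Set ℂ :=
  {m | ∃ l : ℕ → ℂ, (∀ k : ℕ, l k ∈ weylCircle q θ φ (q ^ (-(k : ℤ)))) ∧
    Tendsto l atTop (𝓝 m)}

/-- The Laurent expansion of `m` at `z₀` has a finite principal part, and the coefficient of
`(z - z₀)⁻¹` in it is `r`: the residue of `m` at the pole `z₀` is `r`. -/
def HasResidueAt (m : ℂ → ℂ) (z₀ r : ℂ) : Prop :=
  ∃ (N : ℕ) (a : ℕ → ℂ) (g : ℂ → ℂ), AnalyticAt ℂ g z₀ ∧ a 0 = r ∧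
    ∀ᶠ z in 𝓝[≠] z₀, m z = g z + ∑ k ∈ Finset.range (N + 1), a k / (z - z₀) ^ (k + 1)

/-- `ψ(x, lam) = θ(x, lam) + m(lam) φ(x, lam)`. -/
def weylSolution (θ φ : ℝ → ℂ → ℂ) (m : ℂ → ℂ) (x : ℝ) (lam : ℂ) : ℂ :=
  θ x lam + m lam * φ x lam

/-- The space `𝓛_{q,2}`: `f` and `L f` lie in `L²(ℝ_q^+)`, `f` satisfies the boundary condition
`f(0) cos α + f'(0) sin α = 0`, and `W_x(ψ(·, lam), f) → 0` as `x → ∞` in `ℝ_q^+` for every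
non-real `lam`. -/
def MemDomain (q : ℝ) (V : ℝ → ℝ) (α : ℝ) (ψ : ℝ → ℂ → ℂ) (f : ℝ → ℂ) : Prop :=
  MemL2 q f ∧ MemL2 q (qSchrodinger q V f) ∧
  (∃ a b : ℂ, HasValuesAtZero q f a b ∧
    a * (Real.cos α : ℂ) + b * (Real.sin α : ℂ) = 0) ∧
  ∀ lam : ℂ, lam.im ≠ 0 →
    Tendsto (fun k : ℕ => wronskian q (fun x => ψ x lam) f (q ^ (-(k : ℤ)))) atTop (𝓝 0)

/-- The eigenfunction `ψ_n(x) = √(r_n) φ(x, λ_n)`. -/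
def eigenfunction (φ : ℝ → ℂ → ℂ) (lam : ℕ → ℝ) (r : ℕ → ℂ) (n : ℕ) (x : ℝ) : ℂ :=
  r n ^ (1 / 2 : ℂ) * φ x (lam n : ℂ)

/-- The Fourier coefficient `c_n = ∫_0^∞ ψ_n(y) f(y) d_q y`. -/
def fourierCoef (q : ℝ) (ψ : ℕ → ℝ → ℂ) (f : ℝ → ℂ) (n : ℕ) : ℂ :=
  jackson q fun y => ψ n y * f y

end QSturm

end

/-! The square roots of the weights of Jackson's integral turn the `q`-Schrödinger operator `L` into a
Jacobi operator `J` on `ℓ²(ℤ)`, in which the origin becomes the end `+∞` and the Weyl end becomes `-∞`.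
Functions with values at the origin have Wronskians there (`tendsto_wr_scale`), so `φ` and `θ` form a
`RegularFrame`: solutions of `J u = z u` that are square-summable at `+∞` and normalized by Wronskians
independent of `z`. Variation of constants shows that they are entire in `z`
(`RegularFrame.differentiable_of_boundary`).

That `m(z)` is a limit of points of the Weyl circles implies that `ψ = θ + m φ` is
square-summable and `Im z ‖ψ‖² = -Im m(z)` (`RegularFrame.weyl_solution`); limit-point and limit-circle
case are treated together, by comparing with the minimum of the quadratic function that cuts out the
circle. Hence `m` is real on the real axis, `m(z̄)` is the conjugate of `m(z)`, and `ψ` is locally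
bounded, so holomorphic in norm, off the poles: near real points because `|Im m(z)| ≤ K |Im z|` there.
The norm formula is a relation between the parameters `z` and `z̄`; by holomorphy it extends to
`(z - z') ∫ ψ_z ψ_z' = m(z') - m(z)` for all pairs (`MeromorphicWeyl.pair_weyl`). In the limit-circle
case this contains the statement that the boundary condition at the Weyl end is the same for all
parameters.

Dividing by `m(z)` and letting `z` tend to a pole, where `ψ / m` stays bounded and tends to `φ`, one
obtains that the functions `φ(·, λ_n)` are square-summable and orthogonal, that the poles are simple,
and that `r_n` is the inverse of the squared norm (`MeromorphicWeyl.residue_eq`).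

They are complete (`MeromorphicWeyl.eq_zero_of_pair_eigenvec`): for a vector orthogonal to all of them,
its image under the resolvent, that is, its integral against Green's function, has no poles. It
is entire and bounded by a multiple of `1 / |Im z|`, hence zero.

For `f` in the domain, the coefficients of `L f` are `λ_n c_n`, by the same limit to the poles in the
boundary condition `W(ψ, f) → 0` (`MeromorphicWeyl.pair_eigenvec_jacobi`). So the expansion converges
in the graph norm of `L`, and Green's function at `z = i`, whose norm is uniformly bounded after
division by the square roots of the weights, turns this into uniform convergence (`MeromorphicWeyl.expansion_bound`). -/

open scoped ComplexConjugate

noncomputable section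

namespace QSturm

/-! ### The sequence space and its bilinear pairing -/

/-- The Hilbert space `ℓ²(ℤ)` of complex sequences. -/
abbrev SeqL2 : Type := lp (fun _ : ℤ => ℂ) 2

/-- A square-summable sequence as an element of `ℓ²(ℤ)`; any other sequence is sent to `0`. -/
def toL2 (u : ℤ → ℂ) : SeqL2 := by
  classical exact if h : Memℓp u 2 then ⟨u, h⟩ else 0

lemma toL2_coe {u : ℤ → ℂ} (h : Memℓp u 2) : (toL2 u : ℤ → ℂ) = u := by
  simp [toL2, h]

lemma toL2_apply {u : ℤ → ℂ} (h : Memℓp u 2) (n : ℤ) : (toL2 u : ℤ → ℂ) n = u n := by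
  rw [toL2_coe h]

lemma memℓp_two_iff {u : ℤ → ℂ} : Memℓp u 2 ↔ Summable fun n => ‖u n‖ ^ 2 := by
  rw [memℓp_gen_iff (by norm_num)]
  simp

lemma hasSum_norm_sq (x : SeqL2) : HasSum (fun n => ‖x n‖ ^ 2) (‖x‖ ^ 2) := by
  have := lp.hasSum_norm (p := 2) (by norm_num) x
  simpa using this

lemma norm_le_of_sum_le {x : SeqL2} {C : ℝ} (hC : 0 ≤ C)
    (h : ∀ s : Finset ℤ, ∑ n ∈ s, ‖x n‖ ^ 2 ≤ C ^ 2) : ‖x‖ ≤ C := by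
  refine lp.norm_le_of_forall_sum_le (by norm_num) hC fun s => ?_
  simpa using h s

lemma sum_sq_le (x : SeqL2) (s : Finset ℤ) : ∑ n ∈ s, ‖x n‖ ^ 2 ≤ ‖x‖ ^ 2 :=
  sum_le_hasSum _ (fun _ _ => by positivity) (hasSum_norm_sq x)

/-- The bilinear pairing `∑ₙ xₙ yₙ` on `ℓ²(ℤ)`. -/
def pair : SeqL2 →L[ℂ] SeqL2 →L[ℂ] ℂ :=
  LinearMap.mkContinuous₂
    (LinearMap.mk₂ ℂ (fun x y : SeqL2 => inner ℂ (star x) y)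
      (fun x y z => by rw [star_add, inner_add_left])
      (fun c x y => by rw [star_smul, inner_smul_left]; simp)
      (fun x y z => by rw [inner_add_right])
      (fun c x y => by rw [inner_smul_right]; simp)) 1
    (fun x y => by
      simpa using (norm_inner_le_norm (𝕜 := ℂ) (star x) y).trans_eq (by rw [norm_star]))

lemma pair_eq_inner (x y : SeqL2) : pair x y = inner ℂ (star x) y := rfl

lemma norm_pair_le (x y : SeqL2) : ‖pair x y‖ ≤ ‖x‖ * ‖y‖ := by
  rw [pair_eq_inner]
  simpa using (norm_inner_le_norm (𝕜 := ℂ) (star x) y)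

lemma hasSum_pair (x y : SeqL2) : HasSum (fun n => x n * y n) (pair x y) := by
  have := lp.hasSum_inner (𝕜 := ℂ) (star x) y
  rw [pair_eq_inner]
  have e : (fun n => x n * y n) = fun n => inner ℂ ((star x : SeqL2) n) (y n) := by
    funext n
    change x n * y n = y n * conj (star (x n))
    simp [mul_comm]
  rw [e]
  exact this

lemma pair_comm (x y : SeqL2) : pair x y = pair y x := by
  refine (hasSum_pair x y).unique ?_
  simpa [mul_comm] using hasSum_pair y x

lemma pair_conj_self {x y : SeqL2} (h : ∀ n, y n = conj (x n)) :
    pair x y = ((‖x‖ ^ 2 : ℝ) : ℂ) := by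
  refine (hasSum_pair x y).unique ?_
  have := (Complex.hasSum_ofReal (f := fun n => ‖x n‖ ^ 2)).2 (hasSum_norm_sq x)
  convert this using 2 with n
  rw [h, Complex.mul_conj, Complex.normSq_eq_norm_sq]

lemma toL2_smul {u : ℤ → ℂ} (c : ℂ) (hu : Memℓp u 2) : toL2 (c • u) = c • toL2 u := by
  ext n
  simp [toL2_coe hu, toL2_coe (hu.const_smul c)]

/-- A pointwise limit of sequences of norm at most `C` is square-summable of norm at most `C`. -/
lemma memℓp_and_norm_le_of_tendsto {ι : Type*} {l : Filter ι} [l.NeBot] {U : ι → SeqL2} {u : ℤ → ℂ}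
    {C : ℝ} (hU : ∀ᶠ i in l, ‖U i‖ ≤ C) (h : ∀ n, Tendsto (fun i => U i n) l (𝓝 (u n))) :
    Memℓp u 2 ∧ ‖toL2 u‖ ≤ C := by
  have hC : 0 ≤ C := by
    obtain ⟨i, hi⟩ := hU.exists
    exact (norm_nonneg _).trans hi
  have key : ∀ s : Finset ℤ, ∑ n ∈ s, ‖u n‖ ^ 2 ≤ C ^ 2 := fun s => by
    refine le_of_tendsto (tendsto_finsetSum s fun n _ => ((h n).norm.pow 2)) ?_
    filter_upwards [hU] with i hi
    exact (sum_sq_le (U i) s).trans (by gcongr)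
  have hm : Memℓp u 2 := by
    rw [memℓp_two_iff]
    exact summable_of_sum_le (fun n => by positivity) key
  exact ⟨hm, norm_le_of_sum_le hC fun s => by simpa [toL2_coe hm] using key s⟩

/-- Bounded pointwise convergence in `ℓ²(ℤ)` implies weak convergence. -/
lemma tendsto_pair_of_bounded {ι : Type*} {l : Filter ι} {U : ι → SeqL2} {u : SeqL2}
    {C : ℝ} (hU : ∀ᶠ i in l, ‖U i‖ ≤ C) (h : ∀ n, Tendsto (fun i => U i n) l (𝓝 (u n)))
    (y : SeqL2) : Tendsto (fun i => pair (U i) y) l (𝓝 (pair u y)) := by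
  rcases eq_or_neBot l with rfl | hl
  · simp
  have hC : 0 ≤ C := by
    obtain ⟨i, hi⟩ := hU.exists
    exact (norm_nonneg _).trans hi
  rw [Metric.tendsto_nhds]
  intro ε hε
  set δ : ℝ := ε / (2 * (C + ‖u‖ + 1)) with hδ
  have hpos : 0 < C + ‖u‖ + 1 := by positivity
  have hδ0 : 0 < δ := by positivity
  -- approximate `y` by a finitely supported sequence
  have hsum := lp.hasSum_single (p := 2) (by norm_num) y
  obtain ⟨s, hs⟩ := (((Metric.tendsto_nhds.1 hsum) δ hδ0).exists)
  set y' : SeqL2 := ∑ i ∈ s, lp.single 2 i (y i) with hy'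
  have hfin : ∀ x : SeqL2, pair x y' = ∑ n ∈ s, x n * y n := fun x => by
    rw [hy', map_sum]
    refine Finset.sum_congr rfl fun n _ => ?_
    rw [pair_eq_inner, lp.inner_single_right]
    simp [RCLike.inner_apply, mul_comm]
  have h1 : Tendsto (fun i => pair (U i) y') l (𝓝 (pair u y')) := by
    simp only [hfin]
    exact tendsto_finsetSum _ fun n _ => (h n).mul_const _
  filter_upwards [hU, (Metric.tendsto_nhds.1 h1) (ε / 2) (by positivity)] with i hi hi2
  have e : pair (U i) y - pair u y = (pair (U i) y' - pair u y') + pair (U i - u) (y - y') := by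
    simp only [map_sub, sub_apply]; ring
  rw [dist_eq_norm] at hi2 ⊢
  rw [e]
  have h2 : ‖pair (U i - u) (y - y')‖ ≤ (C + ‖u‖) * δ := by
    refine (norm_pair_le _ _).trans ?_
    rw [dist_comm, dist_eq_norm] at hs
    gcongr
    exact (norm_sub_le _ _).trans (by gcongr)
  have h3 : (C + ‖u‖) * δ < ε / 2 := by
    rw [hδ, mul_div_assoc', div_lt_iff₀ (by positivity)]
    nlinarith
  calc _ ≤ _ := norm_add_le _ _
    _ < ε := by linarith

/-! ### Jacobi operators and Green's formula -/

/-- The Jacobi operator `(J F)ₙ = dₙ Fₙ - pₙ Fₙ₋₁ - pₙ₊₁ Fₙ₊₁`. -/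
def jacobi (p d : ℤ → ℝ) (F : ℤ → ℂ) (n : ℤ) : ℂ :=
  d n * F n - p n * F (n - 1) - p (n + 1) * F (n + 1)

/-- The Wronskian `pₙ (Fₙ Gₙ₋₁ - Gₙ Fₙ₋₁)`. -/
def wr (p : ℤ → ℝ) (F G : ℤ → ℂ) (n : ℤ) : ℂ := p n * (F n * G (n - 1) - G n * F (n - 1))

lemma wr_swap (p : ℤ → ℝ) (F G : ℤ → ℂ) (n : ℤ) : wr p G F n = -wr p F G n := by
  simp only [wr]; ring

lemma wr_conj (p : ℤ → ℝ) (F G : ℤ → ℂ) (n : ℤ) :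
    wr p (fun k => conj (F k)) (fun k => conj (G k)) n = conj (wr p F G n) := by
  simp [wr]

/-- Plücker's relation between the Wronskians of four sequences. -/
lemma wr_pluecker (p : ℤ → ℝ) (A B F G : ℤ → ℂ) (n : ℤ) :
    wr p A B n * wr p F G n - wr p A F n * wr p B G n + wr p A G n * wr p B F n = 0 := by
  simp only [wr]; ring

lemma mul_wr (p : ℤ → ℝ) (F G K : ℤ → ℂ) (n : ℤ) :
    F n * wr p G K n = G n * wr p F K n - K n * wr p F G n := by
  simp only [wr]; ring

lemma green_step (p d : ℤ → ℝ) (F G : ℤ → ℂ) (n : ℤ) :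
    jacobi p d F n * G n - F n * jacobi p d G n = wr p F G n - wr p F G (n + 1) := by
  simp only [wr, jacobi, add_sub_cancel_right]; ring

lemma green_sum (p d : ℤ → ℝ) (F G : ℤ → ℂ) (a : ℤ) (N : ℕ) :
    ∑ n ∈ Finset.Ico a (a + N), (jacobi p d F n * G n - F n * jacobi p d G n)
      = wr p F G a - wr p F G (a + N) := by
  induction N with
  | zero => simp
  | succ N ih =>
    have : Finset.Ico a (a + (N + 1 : ℕ)) = insert (a + N : ℤ) (Finset.Ico a (a + N)) := by
      ext x; simp only [Finset.mem_Ico, Finset.mem_insert]; push_cast; omega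
    rw [this, Finset.sum_insert (by simp), ih, green_step]
    push_cast; ring_nf

/-- `J u = z u`. -/
def IsEigen (p d : ℤ → ℝ) (z : ℂ) (u : ℤ → ℂ) : Prop := ∀ n, jacobi p d u n = z * u n

lemma IsEigen.green_step {p d : ℤ → ℝ} {z z' : ℂ} {F G : ℤ → ℂ} (hF : IsEigen p d z F)
    (hG : IsEigen p d z' G) (n : ℤ) :
    (z - z') * (F n * G n) = wr p F G n - wr p F G (n + 1) := by
  rw [← QSturm.green_step p d F G n, hF n, hG n]; ring

lemma IsEigen.add_smul {p d : ℤ → ℝ} {z : ℂ} {F G : ℤ → ℂ} (hF : IsEigen p d z F)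
    (hG : IsEigen p d z G) (a b : ℂ) : IsEigen p d z (fun n => a * F n + b * G n) := fun n => by
  have h1 := hF n
  have h2 := hG n
  simp only [jacobi] at *
  linear_combination a * h1 + b * h2

/-- The sequence `u` cut off to the indices `≥ k`. -/
def tail (k : ℤ) (u : ℤ → ℂ) : ℤ → ℂ := fun n => if k ≤ n then u n else 0

lemma tail_of_le {k n : ℤ} (h : k ≤ n) (u : ℤ → ℂ) : tail k u n = u n := by simp [tail, h]

lemma tail_of_lt {k n : ℤ} (h : n < k) (u : ℤ → ℂ) : tail k u n = 0 := by
  simp [tail, not_le.2 h]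

/-- `u` is square-summable at `+∞`. -/
def TailL2 (u : ℤ → ℂ) : Prop := ∀ k, Memℓp (tail k u) 2

lemma tailL2_of_nat {u : ℤ → ℂ} (h : Summable fun i : ℕ => ‖u i‖ ^ 2) : TailL2 u := by
  intro k
  rw [memℓp_two_iff]
  refine Summable.of_nat_of_neg_add_one (h.of_nonneg_of_le (fun _ => by positivity) fun n => ?_)
    (summable_of_ne_finset_zero (s := Finset.range (-k).toNat) fun n hn => ?_)
  · by_cases hk : k ≤ n
    · rw [tail_of_le hk]
    · rw [tail_of_lt (not_le.1 hk)]
      rw [norm_zero, zero_pow two_ne_zero]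
      positivity
  · rw [tail_of_lt (by simp only [Finset.mem_range] at hn; omega)]
    simp

lemma TailL2.of_memℓp {u : ℤ → ℂ} (hu : Memℓp u 2) : TailL2 u := by
  refine tailL2_of_nat ?_
  exact (memℓp_two_iff.1 hu).comp_injective Nat.cast_injective

lemma tail_add_smul (k : ℤ) (u v : ℤ → ℂ) (a b : ℂ) :
    tail k (fun n => a * u n + b * v n) = a • tail k u + b • tail k v := by
  funext n
  by_cases h : k ≤ n <;> simp [tail, h]

lemma TailL2.add_smul {u v : ℤ → ℂ} (hu : TailL2 u) (hv : TailL2 v) (a b : ℂ) :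
    TailL2 (fun n => a * u n + b * v n) := fun k => by
  rw [tail_add_smul]
  exact ((hu k).const_smul a).add ((hv k).const_smul b)

lemma hasSum_tail_norm {u : ℤ → ℂ} (hu : TailL2 u) (k : ℤ) :
    HasSum (fun n => ‖tail k u n‖ ^ 2) (‖toL2 (tail k u)‖ ^ 2) := by
  simpa [toL2_coe (hu k)] using hasSum_norm_sq (toL2 (tail k u))

lemma norm_tail_le {u : ℤ → ℂ} (hu : Memℓp u 2) (k : ℤ) : ‖toL2 (tail k u)‖ ≤ ‖toL2 u‖ := by
  have ht := TailL2.of_memℓp hu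
  refine norm_le_of_sum_le (norm_nonneg _) fun s => ?_
  refine le_trans (Finset.sum_le_sum fun n _ => ?_) (sum_sq_le (toL2 u) s)
  rw [toL2_apply (ht k), toL2_apply hu]
  by_cases h : k ≤ n
  · rw [tail_of_le h]
  · rw [tail_of_lt (not_le.1 h)]
    rw [norm_zero, zero_pow two_ne_zero]
    positivity

lemma norm_tail_anti {u : ℤ → ℂ} (hu : TailL2 u) {k k' : ℤ} (h : k ≤ k') :
    ‖toL2 (tail k' u)‖ ≤ ‖toL2 (tail k u)‖ := by
  have : tail k' u = tail k' (tail k u) := by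
    funext n
    by_cases h1 : k' ≤ n
    · rw [tail_of_le h1, tail_of_le h1, tail_of_le (h.trans h1)]
    · rw [tail_of_lt (not_le.1 h1), tail_of_lt (not_le.1 h1)]
  rw [this]
  exact norm_tail_le (hu k) k'

lemma tendsto_sum_Ico_of_hasSum {h : ℤ → ℂ} {S : ℂ} (hs : HasSum h S) (k : ℤ)
    (hk : ∀ n < k, h n = 0) :
    Tendsto (fun N : ℕ => ∑ n ∈ Finset.Ico k (k + N), h n) atTop (𝓝 S) := by
  have h1 : Tendsto (fun N : ℕ => ∑ n ∈ Finset.range N, h (k + n)) atTop (𝓝 S) := by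
    refine HasSum.tendsto_sum_nat (f := fun n : ℕ => h (k + n)) ?_
    have hi : Function.Injective fun n : ℕ => k + (n : ℤ) := fun a b hab => by
      simpa using hab
    refine (hi.hasSum_iff fun x hx => hk x ?_).2 hs
    by_contra hx'
    exact hx ⟨(x - k).toNat, by simp only; omega⟩
  convert h1 using 2 with N
  refine Finset.sum_bij' (fun n _ => (n - k).toNat) (fun n _ => k + (n : ℤ)) ?_ ?_ ?_ ?_ ?_
  · intro a ha; simp only [Finset.mem_Ico, Finset.mem_range] at *; omega
  · intro a ha; simp only [Finset.mem_Ico, Finset.mem_range] at *; omega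
  · intro a ha; simp only [Finset.mem_Ico] at *; omega
  · intro a ha; simp
  · intro a ha; simp only [Finset.mem_Ico] at *; congr 1; omega

/-- Green's formula on the half-line `n ≥ k`. -/
lemma green_tail {p d : ℤ → ℝ} {z z' : ℂ} {F G : ℤ → ℂ} (hF : IsEigen p d z F)
    (hG : IsEigen p d z' G) (htF : TailL2 F) {k : ℤ} {y : SeqL2} (hy : ∀ n, k ≤ n → y n = G n)
    {ω : ℂ} (hω : Tendsto (wr p F G) atTop (𝓝 ω)) :
    (z - z') * pair (toL2 (tail k F)) y = wr p F G k - ω := by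
  have h1 := (hasSum_pair (toL2 (tail k F)) y).mul_left (z - z')
  have h2 := tendsto_sum_Ico_of_hasSum h1 k (fun n hn => by
    rw [toL2_apply (htF k), tail_of_lt hn]; simp)
  refine tendsto_nhds_unique h2 ?_
  have h3 : ∀ N : ℕ, ∑ n ∈ Finset.Ico k (k + N),
      (z - z') * ((toL2 (tail k F) : ℤ → ℂ) n * y n) = wr p F G k - wr p F G (k + N) := by
    intro N
    rw [← green_sum p d]
    refine Finset.sum_congr rfl fun n hn => ?_
    have hn' : k ≤ n := (Finset.mem_Ico.1 hn).1
    rw [toL2_apply (htF k), tail_of_le hn', hy n hn', hF n, hG n]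
    ring
  simp only [h3]
  refine tendsto_const_nhds.sub (hω.comp ?_)
  exact tendsto_atTop_add_const_left _ _ tendsto_natCast_atTop_atTop

/-- Green's formula on the whole line. -/
lemma green_full {p d : ℤ → ℝ} {x y x' y' : SeqL2} (hx : ∀ n, x' n = jacobi p d x n)
    (hy : ∀ n, y' n = jacobi p d y n) {ω ω' : ℂ} (hω : Tendsto (wr p x y) atTop (𝓝 ω))
    (hω' : Tendsto (fun k : ℕ => wr p x y (-(k : ℤ))) atTop (𝓝 ω')) :
    pair x' y - pair x y' = ω' - ω := by
  have h1 := ((hasSum_pair x' y).sub (hasSum_pair x y')).comp (Finset.tendsto_Ico_neg (R := ℤ))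
  refine tendsto_nhds_unique h1 ?_
  have h3 : ∀ N : ℕ, ∑ n ∈ Finset.Ico (-(N : ℤ)) N, (x' n * y n - x n * y' n)
      = wr p x y (-(N : ℤ)) - wr p x y N := by
    intro N
    have := green_sum p d x y (-(N : ℤ)) (2 * N)
    rw [show (-(N : ℤ) + (2 * N : ℕ)) = N by push_cast; ring] at this
    rw [← this]
    exact Finset.sum_congr rfl fun n _ => by rw [hx, hy]
  simp only [Function.comp_def, h3]
  exact hω'.sub (hω.comp tendsto_natCast_atTop_atTop)

/-! ### Holomorphic families in the sequence space -/

/-- A bounded family in `ℓ²(ℤ)` whose coordinates are holomorphic is holomorphic in norm: the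
Schwarz lemma bounds the first-order Taylor remainders of the finite truncations uniformly. -/
lemma differentiableAt_of_coord {U : ℂ → SeqL2} {c : ℂ} {R M : ℝ} (hR : 0 < R)
    (hd : ∀ n, DifferentiableOn ℂ (fun z => U z n) (Metric.ball c R))
    (hb : ∀ z ∈ Metric.ball c R, ‖U z‖ ≤ M) : DifferentiableAt ℂ U c := by
  have hcb : c ∈ Metric.ball c R := Metric.mem_ball_self hR
  have hM : 0 ≤ M := (norm_nonneg _).trans (hb c hcb)
  set a : ℤ → ℂ := fun n => deriv (fun z => U z n) c with ha
  let g : Finset ℤ → ℂ → SeqL2 := fun s z =>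
    ∑ n ∈ s, lp.singleContinuousLinearMap ℂ (fun _ : ℤ => ℂ) 2 n (U z n)
  have hgn : ∀ s z, ∀ n ∈ s, g s z n = U z n := fun s z n hn => by
    simp only [g, lp.coeFn_sum, Finset.sum_apply, lp.singleContinuousLinearMap_apply,
      lp.single_apply]
    simp [Pi.single_apply, hn]
  have hgd : ∀ s, DifferentiableOn ℂ (g s) (Metric.ball c R) := fun s =>
    DifferentiableOn.fun_sum fun n _ =>
      (ContinuousLinearMap.differentiable _).comp_differentiableOn (hd n)
  have hgb : ∀ s, ∀ z ∈ Metric.ball c R, ‖g s z‖ ≤ M := fun s z hz => by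
    refine le_trans ?_ (hb z hz)
    have h1 := lp.norm_sum_single (p := 2) (by norm_num) (U z : ℤ → ℂ) s
    have h2 : ‖g s z‖ ^ 2 = ∑ n ∈ s, ‖U z n‖ ^ 2 := by simpa [g] using h1
    exact pow_le_pow_iff_left₀ (norm_nonneg _) (norm_nonneg _) two_ne_zero |>.1
      (h2.trans_le (sum_sq_le _ s))
  -- uniform first-order Taylor bound for the truncations
  have hnhds : Metric.ball c R ∈ 𝓝 c := Metric.ball_mem_nhds c hR
  have hsl : ∀ s, ∀ z ∈ Metric.ball c R, ‖dslope (g s) c z‖ ≤ 2 * M / R := fun s z hz =>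
    Complex.norm_dslope_le_div_of_mapsTo_ball (hgd s) (fun w hw => by
      rw [Metric.mem_closedBall, dist_eq_norm]
      exact (norm_sub_le _ _).trans (by linarith [hgb s w hw, hgb s c hcb])) hz
  have hsl2 : ∀ s, ∀ z ∈ Metric.ball c R,
      ‖dslope (g s) c z - deriv (g s) c‖ ≤ 4 * M / R / R * ‖z - c‖ := fun s z hz => by
    have := Complex.dist_le_div_mul_dist_of_mapsTo_ball (R₂ := 4 * M / R)
      ((Complex.differentiableOn_dslope hnhds).2 (hgd s)) (fun w hw => by
        rw [Metric.mem_closedBall, dist_eq_norm]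
        refine (norm_sub_le _ _).trans ?_
        have := hsl s w hw
        have := hsl s c hcb
        have e : 4 * M / R = 2 * M / R + 2 * M / R := by ring
        linarith) hz
    rwa [dslope_same, dist_eq_norm, dist_eq_norm] at this
  have hrem : ∀ s, ∀ z ∈ Metric.ball c R,
      ‖g s z - g s c - (z - c) • deriv (g s) c‖ ≤ 4 * M / R / R * ‖z - c‖ ^ 2 := fun s z hz => by
    rw [← sub_smul_dslope (g s) c z, ← smul_sub, norm_smul]
    nlinarith [hsl2 s z hz, norm_nonneg (z - c)]
  have hDn : ∀ s, ∀ n ∈ s, deriv (g s) c n = a n := fun s n hn => by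
    have h1 : HasDerivAt (fun z => lp.evalCLM ℂ (fun _ : ℤ => ℂ) 2 n (g s z))
        (lp.evalCLM ℂ (fun _ : ℤ => ℂ) 2 n (deriv (g s) c)) c :=
      (lp.evalCLM ℂ (fun _ : ℤ => ℂ) 2 n).hasFDerivAt.comp_hasDerivAt c
        ((hgd s).differentiableAt hnhds).hasDerivAt
    have h2 : (fun z => lp.evalCLM ℂ (fun _ : ℤ => ℂ) 2 n (g s z)) = fun z => U z n := by
      funext z
      exact hgn s z n hn
    rw [h2] at h1
    exact h1.deriv.symm
  have hD : Memℓp a 2 := by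
    rw [memℓp_two_iff]
    refine summable_of_sum_le (c := (2 * M / R) ^ 2) (fun n => by positivity) fun s => ?_
    rw [Finset.sum_congr rfl fun n hn => by rw [← hDn s n hn]]
    refine (sum_sq_le _ s).trans ?_
    have := hsl s c hcb
    rw [dslope_same] at this
    gcongr
  have hfin : ∀ z ∈ Metric.ball c R,
      ‖U z - U c - (z - c) • toL2 a‖ ≤ 4 * M / R / R * ‖z - c‖ ^ 2 := fun z hz => by
    refine norm_le_of_sum_le (by positivity) fun s => ?_
    have e : ∀ n ∈ s, (U z - U c - (z - c) • toL2 a : SeqL2) n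
        = (g s z - g s c - (z - c) • deriv (g s) c : SeqL2) n := fun n hn => by
      have h1 := hgn s z n hn
      have h2 := hgn s c n hn
      have h3 := hDn s n hn
      simp only [lp.coeFn_sub, lp.coeFn_smul, Pi.sub_apply, Pi.smul_apply]
      change U z n - U c n - (z - c) • (toL2 a : ℤ → ℂ) n
        = g s z n - g s c n - (z - c) • ((deriv (g s) c : SeqL2) : ℤ → ℂ) n
      rw [h1, h2, h3, toL2_apply hD]
    rw [Finset.sum_congr rfl fun n hn => by rw [e n hn]]
    refine (sum_sq_le _ s).trans ?_
    have := hrem s z hz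
    gcongr
  have : HasDerivAt U (toL2 a) c := by
    rw [hasDerivAt_iff_isLittleO]
    have h1 : (fun z => U z - U c - (z - c) • toL2 a) =O[𝓝 c] fun z => ‖z - c‖ ^ 2 := by
      refine Asymptotics.IsBigO.of_bound (4 * M / R / R) ?_
      filter_upwards [hnhds] with z hz
      simpa using hfin z hz
    refine h1.trans_isLittleO ?_
    have h2 : (fun x : ℂ => ‖x‖ ^ 2) =o[𝓝 0] fun x : ℂ => x := by
      simpa using (Asymptotics.isLittleO_norm_pow_id (E' := ℂ) one_lt_two)
    have h3 : Tendsto (fun z : ℂ => z - c) (𝓝 c) (𝓝 0) := by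
      simpa using (continuous_id.sub continuous_const).tendsto (x := c) (f := fun z : ℂ => z - c)
    exact h2.comp_tendsto h3
  exact this.differentiableAt

lemma norm_le_of_coord_le {x y w : SeqL2} {a b : ℝ} (ha : 0 ≤ a) (hb : 0 ≤ b)
    (h : ∀ n, ‖x n‖ ≤ a * ‖y n‖ + b * ‖w n‖) : ‖x‖ ≤ a * ‖y‖ + b * ‖w‖ := by
  have hm : ∀ v : SeqL2, Memℓp (fun n => (‖v n‖ : ℂ)) 2 := fun v => by
    have := memℓp_two_iff.1 (lp.memℓp v)
    rw [memℓp_two_iff]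
    simpa using this
  have hn : ∀ v : SeqL2, ‖toL2 (fun n => (‖v n‖ : ℂ))‖ ≤ ‖v‖ := fun v => by
    refine norm_le_of_sum_le (norm_nonneg _) fun s => ?_
    refine le_trans (Finset.sum_le_sum fun n _ => ?_) (sum_sq_le v s)
    rw [toL2_apply (hm v)]
    simp
  set Y := toL2 (fun n => (‖y n‖ : ℂ)) with hY
  set W := toL2 (fun n => (‖w n‖ : ℂ)) with hW
  have hle : ‖(a : ℂ) • Y + (b : ℂ) • W‖ ≤ a * ‖y‖ + b * ‖w‖ := by
    refine (norm_add_le _ _).trans ?_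
    rw [norm_smul, norm_smul, Complex.norm_real, Complex.norm_real, Real.norm_of_nonneg ha,
      Real.norm_of_nonneg hb]
    exact add_le_add (mul_le_mul_of_nonneg_left (hn y) ha) (mul_le_mul_of_nonneg_left (hn w) hb)
  refine (norm_le_of_sum_le (norm_nonneg _) fun s => ?_).trans hle
  refine le_trans (Finset.sum_le_sum fun n _ => ?_) (sum_sq_le ((a : ℂ) • Y + (b : ℂ) • W) s)
  have e : ((a : ℂ) • Y + (b : ℂ) • W : SeqL2) n = ((a * ‖y n‖ + b * ‖w n‖ : ℝ) : ℂ) := by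
    rw [lp.coeFn_add, lp.coeFn_smul, lp.coeFn_smul, hY, hW, toL2_coe (hm y), toL2_coe (hm w)]
    push_cast
    rfl
  rw [e, Complex.norm_real, Real.norm_of_nonneg (by positivity)]
  exact pow_le_pow_left₀ (norm_nonneg _) (h n) 2

/-! ### Solutions normalized at the regular end -/

lemma wr_const {p d : ℤ → ℝ} {z : ℂ} {F G : ℤ → ℂ} (hF : IsEigen p d z F) (hG : IsEigen p d z G)
    {ω : ℂ} (hω : Tendsto (wr p F G) atTop (𝓝 ω)) (n : ℤ) : wr p F G n = ω := by
  have h : ∀ k : ℕ, wr p F G (n + k) = wr p F G n := fun k => by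
    induction k with
    | zero => simp
    | succ k ih =>
      have := hF.green_step hG (n + k)
      rw [sub_self, zero_mul, eq_comm, sub_eq_zero] at this
      rw [← ih, this]
      push_cast
      ring_nf
  have h1 : Tendsto (fun k : ℕ => wr p F G (n + k)) atTop (𝓝 ω) :=
    hω.comp (tendsto_atTop_add_const_left _ _ tendsto_natCast_atTop_atTop)
  simp only [h] at h1
  exact tendsto_nhds_unique tendsto_const_nhds h1

/-- For every `z`, two solutions `φ z`, `θ z` of `J u = z u` that are square-summable at `+∞`, real
in the sense of conjugation, and normalized by their Wronskians at `+∞`; these Wronskians do not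
depend on the spectral parameters, so that `φ` and `θ` satisfy boundary conditions independent
of `z`. -/
structure RegularFrame (p d : ℤ → ℝ) (φ θ : ℂ → ℤ → ℂ) : Prop where
  eigen_φ : ∀ z, IsEigen p d z (φ z)
  eigen_θ : ∀ z, IsEigen p d z (θ z)
  conj_φ : ∀ z n, conj (φ z n) = φ (conj z) n
  conj_θ : ∀ z n, conj (θ z n) = θ (conj z) n
  tail_φ : ∀ z, TailL2 (φ z)
  tail_θ : ∀ z, TailL2 (θ z)
  wr_φφ : ∀ z z', Tendsto (wr p (φ z) (φ z')) atTop (𝓝 0)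
  wr_φθ : ∀ z z', Tendsto (wr p (φ z) (θ z')) atTop (𝓝 1)
  wr_θθ : ∀ z z', Tendsto (wr p (θ z) (θ z')) atTop (𝓝 0)

namespace RegularFrame

variable {p d : ℤ → ℝ} {φ θ : ℂ → ℤ → ℂ}

lemma wr_θφ (h : RegularFrame p d φ θ) (z z' : ℂ) :
    Tendsto (wr p (θ z) (φ z')) atTop (𝓝 (-1)) := by
  refine (h.wr_φθ z' z).neg.congr fun n => ?_
  rw [wr_swap p (φ z') (θ z) n]

lemma wr_eq_one (h : RegularFrame p d φ θ) (z : ℂ) (n : ℤ) : wr p (φ z) (θ z) n = 1 :=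
  wr_const (h.eigen_φ z) (h.eigen_θ z) (h.wr_φθ z z) n

/-- Variation of constants: the dependence on the spectral parameter of a solution with fixed
boundary values at `+∞`. -/
lemma sub_eq (h : RegularFrame p d φ θ) {u : ℂ → ℤ → ℂ} {a b : ℂ}
    (hu : ∀ z, IsEigen p d z (u z)) (htu : ∀ z, TailL2 (u z))
    (ha : ∀ z z', Tendsto (wr p (u z) (φ z')) atTop (𝓝 a))
    (hb : ∀ z z', Tendsto (wr p (u z) (θ z')) atTop (𝓝 b)) (z c : ℂ) (k n : ℤ) (hn : k ≤ n) :
    u z n - u c n = (z - c) *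
      (φ c n * pair (toL2 (tail n (u z))) (toL2 (tail k (θ c)))
        - θ c n * pair (toL2 (tail n (u z))) (toL2 (tail k (φ c)))) := by
  have hk : ∀ {v : ℤ → ℂ}, TailL2 v → ∀ m, n ≤ m → toL2 (tail k v) m = v m := fun hv m hm => by
    rw [toL2_apply (hv k), tail_of_le (hn.trans hm)]
  have e1 := green_tail (k := n) (hu z) (h.eigen_θ c) (htu z) (hk (h.tail_θ c)) (hb z c)
  have e2 := green_tail (k := n) (hu z) (h.eigen_φ c) (htu z) (hk (h.tail_φ c)) (ha z c)
  have e3 := mul_wr p (u z) (φ c) (θ c) n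
  have e4 := mul_wr p (u c) (φ c) (θ c) n
  rw [h.wr_eq_one] at e3 e4
  rw [wr_const (hu c) (h.eigen_θ c) (hb c c), wr_const (hu c) (h.eigen_φ c) (ha c c)] at e4
  linear_combination e3 - e4 - φ c n * e1 + θ c n * e2

lemma norm_tail_sub_le (h : RegularFrame p d φ θ) {u : ℂ → ℤ → ℂ} {a b : ℂ}
    (hu : ∀ z, IsEigen p d z (u z)) (htu : ∀ z, TailL2 (u z))
    (ha : ∀ z z', Tendsto (wr p (u z) (φ z')) atTop (𝓝 a))
    (hb : ∀ z z', Tendsto (wr p (u z) (θ z')) atTop (𝓝 b)) (z c : ℂ) (k : ℤ) :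
    ‖toL2 (tail k (u z)) - toL2 (tail k (u c))‖ ≤ ‖z - c‖ * ‖toL2 (tail k (u z))‖ *
      (2 * ‖toL2 (tail k (φ c))‖ * ‖toL2 (tail k (θ c))‖) := by
  have hle : ∀ n, ‖(toL2 (tail k (u z)) - toL2 (tail k (u c)) : SeqL2) n‖
      ≤ (‖z - c‖ * ‖toL2 (tail k (u z))‖ * ‖toL2 (tail k (θ c))‖) * ‖toL2 (tail k (φ c)) n‖
        + (‖z - c‖ * ‖toL2 (tail k (u z))‖ * ‖toL2 (tail k (φ c))‖) * ‖toL2 (tail k (θ c)) n‖ := by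
    intro n
    have e1 : (toL2 (tail k (u z)) - toL2 (tail k (u c)) : SeqL2) n
        = tail k (u z) n - tail k (u c) n := by
      rw [lp.coeFn_sub, toL2_coe (htu z k), toL2_coe (htu c k)]; rfl
    rw [e1, toL2_apply (h.tail_φ c k), toL2_apply (h.tail_θ c k)]
    by_cases hn : k ≤ n
    · rw [tail_of_le hn, tail_of_le hn, tail_of_le hn, tail_of_le hn,
        h.sub_eq hu htu ha hb z c k n hn, norm_mul]
      have hNn := norm_tail_anti (htu z) hn
      have h1 := (norm_pair_le (toL2 (tail n (u z))) (toL2 (tail k (θ c)))).trans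
        (mul_le_mul_of_nonneg_right hNn (norm_nonneg _))
      have h2 := (norm_pair_le (toL2 (tail n (u z))) (toL2 (tail k (φ c)))).trans
        (mul_le_mul_of_nonneg_right hNn (norm_nonneg _))
      have h3 := add_le_add (mul_le_mul_of_nonneg_left h1 (norm_nonneg (φ c n)))
        (mul_le_mul_of_nonneg_left h2 (norm_nonneg (θ c n)))
      rw [← norm_mul, ← norm_mul] at h3
      refine (mul_le_mul_of_nonneg_left ((norm_sub_le _ _).trans h3) (norm_nonneg _)).trans_eq ?_
      ring
    · rw [tail_of_lt (not_le.1 hn), tail_of_lt (not_le.1 hn), sub_zero, norm_zero]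
      positivity
  refine (norm_le_of_coord_le (by positivity) (by positivity) hle).trans_eq ?_
  ring

/-- The tails of a solution with fixed boundary values are locally bounded in the spectral
parameter, and continuous. -/
lemma tail_bound (h : RegularFrame p d φ θ) {u : ℂ → ℤ → ℂ} {a b : ℂ}
    (hu : ∀ z, IsEigen p d z (u z)) (htu : ∀ z, TailL2 (u z))
    (ha : ∀ z z', Tendsto (wr p (u z) (φ z')) atTop (𝓝 a))
    (hb : ∀ z z', Tendsto (wr p (u z) (θ z')) atTop (𝓝 b)) (c : ℂ) (k : ℤ) :
    ∃ R > 0, ∃ D ≥ 0, ∀ z ∈ Metric.ball c R,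
      ‖toL2 (tail k (u z))‖ ≤ 2 * ‖toL2 (tail k (u c))‖ ∧
      ‖toL2 (tail k (u z)) - toL2 (tail k (u c))‖ ≤ D * ‖z - c‖ := by
  obtain ⟨D, hD⟩ : ∃ D, D = 2 * ‖toL2 (tail k (φ c))‖ * ‖toL2 (tail k (θ c))‖ := ⟨_, rfl⟩
  have hD0 : 0 ≤ D := by rw [hD]; positivity
  refine ⟨1 / (2 * (D + 1)), by positivity, 2 * ‖toL2 (tail k (u c))‖ * D, by positivity,
    fun z hz => ?_⟩
  rw [Metric.mem_ball, dist_eq_norm, lt_div_iff₀ (by positivity)] at hz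
  have h1 := h.norm_tail_sub_le hu htu ha hb z c k
  rw [← hD] at h1
  have h2 := norm_sub_norm_le (toL2 (tail k (u z))) (toL2 (tail k (u c)))
  have h0 := norm_nonneg (toL2 (tail k (u z)))
  generalize ‖toL2 (tail k (u z)) - toL2 (tail k (u c))‖ = δ at *
  generalize ‖toL2 (tail k (u z))‖ = N at *
  generalize ‖toL2 (tail k (u c))‖ = N₀ at *
  have h3 : ‖z - c‖ * N * D ≤ N / 2 := by nlinarith [norm_nonneg (z - c)]
  have h4 : N ≤ 2 * N₀ := by linarith
  refine ⟨h4, h1.trans ?_⟩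
  calc ‖z - c‖ * N * D ≤ ‖z - c‖ * (2 * N₀) * D := by gcongr
    _ = _ := by ring

lemma differentiable_of_boundary (h : RegularFrame p d φ θ) {u : ℂ → ℤ → ℂ} {a b : ℂ}
    (hu : ∀ z, IsEigen p d z (u z)) (htu : ∀ z, TailL2 (u z))
    (ha : ∀ z z', Tendsto (wr p (u z) (φ z')) atTop (𝓝 a))
    (hb : ∀ z z', Tendsto (wr p (u z) (θ z')) atTop (𝓝 b)) (n : ℤ) :
    Differentiable ℂ fun z => u z n := fun c => by
  obtain ⟨R, hR, D, hD, hball⟩ := h.tail_bound hu htu ha hb c n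
  have hcont : Tendsto (fun z => toL2 (tail n (u z))) (𝓝 c) (𝓝 (toL2 (tail n (u c)))) := by
    rw [tendsto_iff_norm_sub_tendsto_zero]
    refine squeeze_zero' (Eventually.of_forall fun _ => norm_nonneg _) ?_
      (g := fun z => D * ‖z - c‖) ?_
    · filter_upwards [Metric.ball_mem_nhds c hR] with z hz using (hball z hz).2
    · have : Continuous fun z : ℂ => D * ‖z - c‖ := by fun_prop
      simpa using this.tendsto c
  have hd : HasDerivAt (fun z => u z n)
      (φ c n * pair (toL2 (tail n (u c))) (toL2 (tail n (θ c)))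
        - θ c n * pair (toL2 (tail n (u c))) (toL2 (tail n (φ c)))) c := by
    rw [hasDerivAt_iff_tendsto_slope]
    have hp : ∀ y, Tendsto (fun z => pair (toL2 (tail n (u z))) y) (𝓝[≠] c)
        (𝓝 (pair (toL2 (tail n (u c))) y)) := fun y =>
      (((pair.flip y).continuous.tendsto _).comp hcont).mono_left nhdsWithin_le_nhds
    refine (((hp _).const_mul _).sub ((hp _).const_mul _)).congr' ?_
    filter_upwards [self_mem_nhdsWithin] with z hz
    rw [slope_def_field, h.sub_eq hu htu ha hb z c n n le_rfl,
      mul_div_cancel_left₀ _ (sub_ne_zero.2 hz)]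
  exact hd.differentiableAt

lemma differentiable_φ (h : RegularFrame p d φ θ) (n : ℤ) : Differentiable ℂ fun z => φ z n :=
  h.differentiable_of_boundary h.eigen_φ h.tail_φ h.wr_φφ h.wr_φθ n

lemma differentiable_θ (h : RegularFrame p d φ θ) (n : ℤ) : Differentiable ℂ fun z => θ z n :=
  h.differentiable_of_boundary h.eigen_θ h.tail_θ h.wr_θφ h.wr_θθ n

lemma differentiable_tail (h : RegularFrame p d φ θ) {u : ℂ → ℤ → ℂ} {a b : ℂ}
    (hu : ∀ z, IsEigen p d z (u z)) (htu : ∀ z, TailL2 (u z))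
    (ha : ∀ z z', Tendsto (wr p (u z) (φ z')) atTop (𝓝 a))
    (hb : ∀ z z', Tendsto (wr p (u z) (θ z')) atTop (𝓝 b)) (k : ℤ) :
    Differentiable ℂ fun z => toL2 (tail k (u z)) := fun c => by
  obtain ⟨R, hR, D, -, hball⟩ := h.tail_bound hu htu ha hb c k
  refine differentiableAt_of_coord hR (fun n => ?_) fun z hz => (hball z hz).1
  have hd := h.differentiable_of_boundary hu htu ha hb n
  simp only [toL2_coe (htu _ k)]
  by_cases hn : k ≤ n
  · simpa only [tail_of_le hn] using hd.differentiableOn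
  · simpa only [tail_of_lt (not_le.1 hn)] using differentiableOn_const _

end RegularFrame

/-! ### The Weyl circles -/

lemma tendsto_norm_tail {u : ℤ → ℂ} (hu : Memℓp u 2) :
    Tendsto (fun k : ℕ => ‖toL2 (tail (-(k : ℤ)) u)‖) atTop (𝓝 ‖toL2 u‖) := by
  have ht := TailL2.of_memℓp hu
  have h1 : Tendsto (fun k : ℕ => pair (toL2 (tail (-(k : ℤ)) u)) (star (toL2 u))) atTop
      (𝓝 (pair (toL2 u) (star (toL2 u)))) := by
    refine tendsto_pair_of_bounded (C := ‖toL2 u‖)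
      (Eventually.of_forall fun k => norm_tail_le hu _) (fun n => ?_) _
    refine tendsto_const_nhds.congr' ?_
    filter_upwards [eventually_ge_atTop (-n).toNat] with k hk
    rw [toL2_apply (ht _), toL2_apply hu, tail_of_le (by omega)]
  have h2 : ∀ k : ℕ, pair (toL2 (tail (-(k : ℤ)) u)) (star (toL2 u))
      = ((‖toL2 (tail (-(k : ℤ)) u)‖ ^ 2 : ℝ) : ℂ) := fun k => by
    refine (hasSum_pair _ _).unique ?_
    have := (Complex.hasSum_ofReal (f := fun n => ‖tail (-(k : ℤ)) u n‖ ^ 2)).2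
      (hasSum_tail_norm ht (-(k : ℤ)))
    refine this.congr_fun ?_
    intro n
    have e : (star (toL2 u) : SeqL2) n = conj (u n) := by
      rw [lp.star_apply, toL2_apply hu]; rfl
    rw [e, toL2_apply (ht _)]
    by_cases hn : -(k : ℤ) ≤ n
    · rw [tail_of_le hn, Complex.mul_conj, Complex.normSq_eq_norm_sq]
    · rw [tail_of_lt (not_le.1 hn)]; simp
  rw [pair_conj_self (y := star (toL2 u)) fun n => rfl] at h1
  simp only [h2] at h1
  have h3 := (Complex.continuous_re.tendsto _).comp h1
  simp only [Function.comp_def, Complex.ofReal_re] at h3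
  have h4 := (Real.continuous_sqrt.tendsto _).comp h3
  simpa [Function.comp_def, Real.sqrt_sq (norm_nonneg _)] using h4

/-- The solution `θ + l φ` at the spectral parameter `z`. -/
def sol (φ θ : ℂ → ℤ → ℂ) (z l : ℂ) (n : ℤ) : ℂ := θ z n + l * φ z n

namespace RegularFrame

variable {p d : ℤ → ℝ} {φ θ : ℂ → ℤ → ℂ}

lemma eigen_sol (h : RegularFrame p d φ θ) (z l : ℂ) : IsEigen p d z (sol φ θ z l) := by
  have := (h.eigen_θ z).add_smul (h.eigen_φ z) 1 l
  simp only [one_mul] at this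
  exact this

lemma tail_sol (h : RegularFrame p d φ θ) (z l : ℂ) : TailL2 (sol φ θ z l) := by
  have := (h.tail_θ z).add_smul (h.tail_φ z) 1 l
  simp only [one_mul] at this
  exact this

lemma conj_sol (h : RegularFrame p d φ θ) (z l : ℂ) (n : ℤ) :
    conj (sol φ θ z l n) = sol φ θ (conj z) (conj l) n := by
  simp [sol, h.conj_φ, h.conj_θ]

lemma wr_φ_sol (h : RegularFrame p d φ θ) (z z' l : ℂ) :
    Tendsto (wr p (φ z) (sol φ θ z' l)) atTop (𝓝 1) := by
  have := (h.wr_φθ z z').add ((h.wr_φφ z z').const_mul l)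
  rw [mul_zero, add_zero] at this
  refine this.congr fun n => ?_
  simp only [wr, sol]; ring

lemma wr_sol_sol (h : RegularFrame p d φ θ) (z z' l l' : ℂ) :
    Tendsto (wr p (sol φ θ z l) (sol φ θ z' l')) atTop (𝓝 (l - l')) := by
  have := (((h.wr_θθ z z').add ((h.wr_θφ z z').const_mul l')).add
    ((h.wr_φθ z z').const_mul l)).add ((h.wr_φφ z z').const_mul (l * l'))
  rw [show 0 + l' * -1 + l * 1 + l * l' * 0 = l - l' by ring] at this
  refine this.congr fun n => ?_
  simp only [wr, sol]; ring

/-- Green's formula for a solution and its conjugate. -/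
lemma wr_sol_conj (h : RegularFrame p d φ θ) (z l : ℂ) (n : ℤ) :
    wr p (sol φ θ z l) (fun k => conj (sol φ θ z l k)) n
      = 2 * Complex.I * ((z.im * ‖toL2 (tail n (sol φ θ z l))‖ ^ 2 + l.im : ℝ) : ℂ) := by
  have hc : (fun k => conj (sol φ θ z l k)) = sol φ θ (conj z) (conj l) := by
    funext k; exact h.conj_sol z l k
  have e := green_tail (k := n) (h.eigen_sol z l) (h.eigen_sol (conj z) (conj l)) (h.tail_sol z l)
    (y := toL2 (tail n (sol φ θ (conj z) (conj l))))
    (fun m hm => by rw [toL2_apply (h.tail_sol _ _ n), tail_of_le hm]) (h.wr_sol_sol _ _ _ _)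
  rw [pair_conj_self, ← hc] at e
  · have e1 := Complex.sub_conj z
    have e2 := Complex.sub_conj l
    rw [e1, e2] at e
    push_cast at e ⊢
    linear_combination -e
  · intro m
    rw [toL2_apply (h.tail_sol _ _ n), toL2_apply (h.tail_sol _ _ n)]
    by_cases hm : n ≤ m
    · rw [tail_of_le hm, tail_of_le hm, h.conj_sol]
    · rw [tail_of_lt (not_le.1 hm), tail_of_lt (not_le.1 hm), map_zero]

lemma wr_φ_conj (h : RegularFrame p d φ θ) (z : ℂ) (n : ℤ) :
    wr p (φ z) (fun k => conj (φ z k)) n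
      = 2 * Complex.I * ((z.im * ‖toL2 (tail n (φ z))‖ ^ 2 : ℝ) : ℂ) := by
  have hc : (fun k => conj (φ z k)) = φ (conj z) := by
    funext k; exact h.conj_φ z k
  have e := green_tail (k := n) (h.eigen_φ z) (h.eigen_φ (conj z)) (h.tail_φ z)
    (y := toL2 (tail n (φ (conj z))))
    (fun m hm => by rw [toL2_apply (h.tail_φ _ n), tail_of_le hm]) (h.wr_φφ _ _)
  rw [pair_conj_self, ← hc] at e
  · have e1 := Complex.sub_conj z
    rw [e1] at e
    push_cast at e ⊢
    linear_combination -e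
  · intro m
    rw [toL2_apply (h.tail_φ _ n), toL2_apply (h.tail_φ _ n)]
    by_cases hm : n ≤ m
    · rw [tail_of_le hm, tail_of_le hm, h.conj_φ]
    · rw [tail_of_lt (not_le.1 hm), tail_of_lt (not_le.1 hm), map_zero]

lemma wr_φ_sol_eq (h : RegularFrame p d φ θ) (z l : ℂ) (n : ℤ) :
    wr p (φ z) (sol φ θ z l) n = 1 :=
  wr_const (h.eigen_φ z) (h.eigen_sol z l) (h.wr_φ_sol z z l) n

/-- The value at `l` of the quadratic function cutting out the Weyl circle at `n` is at least its
minimum, attained at the center of the circle. -/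
lemma weyl_disc_bound (h : RegularFrame p d φ θ) (z l : ℂ) (n : ℤ) :
    -1 ≤ 4 * (z.im * ‖toL2 (tail n (φ z))‖ ^ 2) *
      (z.im * ‖toL2 (tail n (sol φ θ z l))‖ ^ 2 + l.im) := by
  have e := wr_pluecker p (φ z) (fun k => conj (φ z k)) (sol φ θ z l)
    (fun k => conj (sol φ θ z l k)) n
  rw [h.wr_sol_conj, h.wr_φ_conj, h.wr_φ_sol_eq, wr_conj, h.wr_φ_sol_eq] at e
  have e2 : wr p (fun k => conj (φ z k)) (sol φ θ z l) n
      = conj (wr p (φ z) (fun k => conj (sol φ θ z l k)) n) := by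
    rw [← wr_conj]; simp
  rw [e2, map_one, Complex.mul_conj] at e
  have e3 : ((4 * (z.im * ‖toL2 (tail n (φ z))‖ ^ 2) *
      (z.im * ‖toL2 (tail n (sol φ θ z l))‖ ^ 2 + l.im) : ℝ) : ℂ)
      = ((Complex.normSq (wr p (φ z) (fun k => conj (sol φ θ z l k)) n) - 1 : ℝ) : ℂ) := by
    push_cast at e ⊢
    linear_combination -e + 4 * ((z.im : ℂ) * (‖toL2 (tail n (φ z))‖ : ℂ) ^ 2) *
      ((z.im : ℂ) * (‖toL2 (tail n (sol φ θ z l))‖ : ℂ) ^ 2 + l.im) * Complex.I_sq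
  rw [Complex.ofReal_inj.1 e3]
  linarith [Complex.normSq_nonneg (wr p (φ z) (fun k => conj (sol φ θ z l k)) n)]

/-- The Weyl solution for a point of the limit circle, or for the limit point, is square-summable
and its norm is given by the imaginary part of that point. -/
lemma weyl_solution (h : RegularFrame p d φ θ) {z m : ℂ} (hz : z.im ≠ 0) {l : ℕ → ℂ}
    (hl : ∀ k : ℕ, wr p (sol φ θ z (l k)) (fun n => conj (sol φ θ z (l k) n)) (-(k : ℤ)) = 0)
    (hlm : Tendsto l atTop (𝓝 m)) :
    Memℓp (sol φ θ z m) 2 ∧ z.im * ‖toL2 (sol φ θ z m)‖ ^ 2 = -m.im := by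
  set U : ℕ → SeqL2 := fun k => toL2 (tail (-(k : ℤ)) (sol φ θ z (l k))) with hU
  have hUn : ∀ k, ‖U k‖ ^ 2 = -(l k).im / z.im := fun k => by
    have := hl k
    rw [h.wr_sol_conj] at this
    have h2 : (2 : ℂ) * Complex.I ≠ 0 := by simp
    have := Complex.ofReal_eq_zero.1 ((mul_eq_zero.1 this).resolve_left h2)
    rw [eq_div_iff hz]
    linarith
  have hUt : Tendsto (fun k => ‖U k‖ ^ 2) atTop (𝓝 (-m.im / z.im)) := by
    simp only [hUn]
    exact (((Complex.continuous_im.tendsto m).comp hlm).neg).div_const _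
  have hUt' : Tendsto (fun k => ‖U k‖) atTop (𝓝 (Real.sqrt (-m.im / z.im))) := by
    have := (Real.continuous_sqrt.tendsto _).comp hUt
    simpa [Function.comp_def, Real.sqrt_sq (norm_nonneg _)] using this
  have hv : 0 ≤ -m.im / z.im := ge_of_tendsto' hUt fun k => by positivity
  have hcoord : ∀ n, Tendsto (fun k => U k n) atTop (𝓝 (sol φ θ z m n)) := fun n => by
    have h1 : Tendsto (fun k => sol φ θ z (l k) n) atTop (𝓝 (sol φ θ z m n)) :=
      (hlm.mul_const _).const_add _
    refine h1.congr' ?_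
    filter_upwards [eventually_ge_atTop (-n).toNat] with k hk
    rw [hU]
    simp only
    rw [toL2_apply (h.tail_sol _ _ _), tail_of_le (by omega)]
  have hfatou : ∀ C, Real.sqrt (-m.im / z.im) < C →
      Memℓp (sol φ θ z m) 2 ∧ ‖toL2 (sol φ θ z m)‖ ≤ C := fun C hC =>
    memℓp_and_norm_le_of_tendsto ((hUt'.eventually (gt_mem_nhds hC)).mono fun _ => le_of_lt) hcoord
  have hmem := (hfatou _ (lt_add_one _)).1
  have hle : ‖toL2 (sol φ θ z m)‖ ≤ Real.sqrt (-m.im / z.im) :=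
    le_of_forall_gt_imp_ge_of_dense fun C hC => (hfatou C hC).2
  refine ⟨hmem, ?_⟩
  have hsq : ‖toL2 (sol φ θ z m)‖ ^ 2 ≤ -m.im / z.im := by
    rw [← Real.sq_sqrt hv]
    gcongr
  suffices hs : ‖toL2 (sol φ θ z m)‖ ^ 2 = -m.im / z.im by
    rw [hs]; field_simp
  by_contra hne
  have hlt : ‖toL2 (sol φ θ z m)‖ ^ 2 < -m.im / z.im := lt_of_le_of_ne hsq hne
  set e := -m.im / z.im - ‖toL2 (sol φ θ z m)‖ ^ 2 with he
  have he0 : 0 < e := by rw [he]; linarith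
  -- strict inequality bounds the tails of `φ`: this is the limit-circle case
  have hφ : Memℓp (φ z) 2 := by
    refine (memℓp_and_norm_le_of_tendsto (l := atTop)
      (U := fun k : ℕ => toL2 (tail (-(k : ℤ)) (φ z)))
      (C := Real.sqrt (1 / (4 * z.im ^ 2 * e))) (Eventually.of_forall fun k => ?_) fun n => ?_).1
    · apply Real.le_sqrt_of_sq_le
      have hb := h.weyl_disc_bound z m (-(k : ℤ))
      have ht : ‖toL2 (tail (-(k : ℤ)) (sol φ θ z m))‖ ^ 2 ≤ ‖toL2 (sol φ θ z m)‖ ^ 2 := by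
        have := norm_tail_le hmem (-(k : ℤ))
        gcongr
      have hm : m.im = -(z.im * (e + ‖toL2 (sol φ θ z m)‖ ^ 2)) := by
        rw [he]; field_simp; ring
      have hz2 : 0 < z.im ^ 2 := by positivity
      rw [le_div_iff₀ (by positivity)]
      rw [hm] at hb
      have := mul_le_mul_of_nonneg_left ht
        (show 0 ≤ 4 * z.im ^ 2 * ‖toL2 (tail (-(k : ℤ)) (φ z))‖ ^ 2 by positivity)
      nlinarith
    · refine tendsto_const_nhds.congr' ?_
      filter_upwards [eventually_ge_atTop (-n).toNat] with k hk
      rw [toL2_apply (h.tail_φ _ _), tail_of_le (by omega)]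
  have h1 : Tendsto (fun k => ‖U k‖) atTop (𝓝 ‖toL2 (sol φ θ z m)‖) := by
    have h2 : ∀ k, |‖U k‖ - ‖toL2 (tail (-(k : ℤ)) (sol φ θ z m))‖| ≤ ‖l k - m‖ * ‖toL2 (φ z)‖ := by
      intro k
      refine (abs_norm_sub_norm_le _ _).trans ?_
      have e1 : U k - toL2 (tail (-(k : ℤ)) (sol φ θ z m))
          = (l k - m) • toL2 (tail (-(k : ℤ)) (φ z)) := by
        ext n
        have a1 := toL2_apply (h.tail_sol z (l k) (-(k : ℤ))) n
        have a2 := toL2_apply (h.tail_sol z m (-(k : ℤ))) n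
        have a3 := toL2_apply (h.tail_φ z (-(k : ℤ))) n
        change U k n - toL2 (tail (-(k : ℤ)) (sol φ θ z m)) n
          = (l k - m) * toL2 (tail (-(k : ℤ)) (φ z)) n
        rw [hU]
        simp only
        rw [a1, a2, a3]
        by_cases hn : -(k : ℤ) ≤ n
        · simp only [tail_of_le hn, sol]; ring
        · simp only [tail_of_lt (not_le.1 hn)]; ring
      rw [e1, norm_smul]
      exact mul_le_mul_of_nonneg_left (norm_tail_le hφ _) (norm_nonneg _)
    have h3 : Tendsto (fun k => ‖U k‖ - ‖toL2 (tail (-(k : ℤ)) (sol φ θ z m))‖) atTop (𝓝 0) := by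
      rw [tendsto_zero_iff_abs_tendsto_zero]
      refine squeeze_zero (fun _ => abs_nonneg _) h2 ?_
      have : Tendsto (fun k => ‖l k - m‖) atTop (𝓝 0) := tendsto_iff_norm_sub_tendsto_zero.1 hlm
      simpa using this.mul_const ‖toL2 (φ z)‖
    simpa using h3.add (tendsto_norm_tail hmem)
  exact hne (tendsto_nhds_unique (h1.pow 2) hUt)

end RegularFrame

/-! ### Complex-analytic auxiliaries -/

/-- A holomorphic function on a connected open set vanishing at the real points near one real
point of the set vanishes identically. -/
lemma eqOn_zero_of_real {f : ℂ → ℂ} {D : Set ℂ} (hD : IsOpen D) (hc : IsPreconnected D)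
    (hf : ∀ z ∈ D, DifferentiableAt ℂ f z) {x : ℝ} (hx : (x : ℂ) ∈ D)
    (h0 : ∀ y : ℝ, (y : ℂ) ∈ D → f y = 0) : ∀ z ∈ D, f z = 0 := by
  have ha : AnalyticOnNhd ℂ f D :=
    DifferentiableOn.analyticOnNhd (fun z hz => (hf z hz).differentiableWithinAt) hD
  refine ha.eqOn_zero_of_preconnected_of_frequently_eq_zero hc hx ?_
  have ht : Tendsto (fun y : ℝ => (y : ℂ)) (𝓝[≠] x) (𝓝[≠] (x : ℂ)) := by
    refine tendsto_nhdsWithin_iff.2 ⟨(Complex.continuous_ofReal.tendsto x).mono_left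
      nhdsWithin_le_nhds, ?_⟩
    filter_upwards [self_mem_nhdsWithin] with y hy
    simpa using hy
  refine ht.frequently (Eventually.frequently ?_)
  have : ∀ᶠ y : ℝ in 𝓝[≠] x, (y : ℂ) ∈ D :=
    ht.eventually (nhdsWithin_le_nhds (hD.mem_nhds hx))
  exact this.mono fun y hy => h0 y hy

/-- A function that is analytic at a real point and real on the real axis satisfies
`|Im A(z)| ≤ K |Im z|` near that point. -/
lemma exists_im_le {A : ℂ → ℂ} {x : ℝ} (hA : AnalyticAt ℂ A x)
    (hr : ∀ᶠ y : ℝ in 𝓝 x, (A y).im = 0) :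
    ∃ K : ℝ, 0 ≤ K ∧ ∃ R > 0, ∀ z ∈ Metric.ball (x : ℂ) R, |(A z).im| ≤ K * |z.im| := by
  obtain ⟨K, t, ht, hK⟩ := ContDiffAt.exists_lipschitzOnWith (hA.contDiffAt (n := 1))
  obtain ⟨R₁, hR₁, h₁⟩ := Metric.mem_nhds_iff.1 ht
  obtain ⟨R₂, hR₂, h₂⟩ := Metric.eventually_nhds_iff_ball.1 hr
  refine ⟨K, K.2, min R₁ R₂, lt_min hR₁ hR₂, fun z hz => ?_⟩
  rw [Metric.mem_ball, dist_eq_norm, lt_min_iff] at hz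
  have hre : |z.re - x| ≤ ‖z - x‖ := by simpa using Complex.abs_re_le_norm (z - x)
  have h3 : (A z.re).im = 0 := h₂ _ (by
    rw [Metric.mem_ball, Real.dist_eq]; exact hre.trans_lt hz.2)
  have h4 : ((z.re : ℝ) : ℂ) ∈ t := h₁ (by
    rw [Metric.mem_ball, dist_eq_norm, ← Complex.ofReal_sub, Complex.norm_real]
    exact hre.trans_lt hz.1)
  have h5 : z ∈ t := h₁ (by rw [Metric.mem_ball, dist_eq_norm]; exact hz.1)
  have h6 := hK.dist_le_mul z h5 _ h4
  rw [dist_eq_norm, dist_eq_norm] at h6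
  have h7 : z - (z.re : ℂ) = z.im * Complex.I := by
    apply Complex.ext <;> simp
  rw [h7, norm_mul, Complex.norm_I, mul_one, Complex.norm_real, Real.norm_eq_abs] at h6
  refine le_trans ?_ h6
  have := Complex.abs_im_le_norm (A z - A z.re)
  simpa [h3] using this

/-- A family with holomorphic coordinates that is bounded in `ℓ²(ℤ)` off the real axis is
bounded also on the real axis, and holomorphic in norm. -/
lemma memℓp_and_differentiableAt_of_nonreal {u : ℂ → ℤ → ℂ} {c : ℂ} {R M : ℝ} (hR : 0 < R)
    (hd : ∀ n, DifferentiableOn ℂ (fun z => u z n) (Metric.ball c R))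
    (hb : ∀ z ∈ Metric.ball c R, z.im ≠ 0 → Memℓp (u z) 2 ∧ ‖toL2 (u z)‖ ≤ M) :
    (∀ z ∈ Metric.ball c R, Memℓp (u z) 2) ∧ DifferentiableAt ℂ (fun z => toL2 (u z)) c := by
  have hall : ∀ z ∈ Metric.ball c R, Memℓp (u z) 2 ∧ ‖toL2 (u z)‖ ≤ M := by
    intro z hz
    by_cases him : z.im = 0
    swap
    · exact hb z hz him
    have ht : Tendsto (fun t : ℝ => z + t * Complex.I) (𝓝[>] 0) (𝓝 z) := by
      have : Continuous fun t : ℝ => z + t * Complex.I := by fun_prop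
      simpa using (this.tendsto 0).mono_left nhdsWithin_le_nhds
    have hev : ∀ᶠ t : ℝ in 𝓝[>] 0, z + t * Complex.I ∈ Metric.ball c R :=
      ht.eventually (Metric.isOpen_ball.mem_nhds hz)
    have hmem : ∀ᶠ t : ℝ in 𝓝[>] 0, Memℓp (u (z + t * Complex.I)) 2 ∧
        ‖toL2 (u (z + t * Complex.I))‖ ≤ M := by
      filter_upwards [hev, self_mem_nhdsWithin] with t ht1 ht2
      refine hb _ ht1 ?_
      simpa [him] using (ne_of_gt ht2)
    refine memℓp_and_norm_le_of_tendsto (hmem.mono fun t h => h.2) fun n => ?_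
    have hcont : ContinuousAt (fun z => u z n) z :=
      ((hd n).differentiableAt (Metric.isOpen_ball.mem_nhds hz)).continuousAt
    refine (hcont.tendsto.comp ht).congr' ?_
    filter_upwards [hmem] with t h
    rw [toL2_apply h.1]
    rfl
  refine ⟨fun z hz => (hall z hz).1, differentiableAt_of_coord (M := M) hR (fun n => ?_)
    fun z hz => (hall z hz).2⟩
  exact (hd n).congr fun z hz => toL2_apply (hall z hz).1 n

/-! ### The Weyl function on its domain of holomorphy -/

/-- The complement of the set of poles. -/
def regularSet (lam : ℕ → ℝ) : Set ℂ := (Set.range fun n => (lam n : ℂ))ᶜ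

/-- A regular frame together with a Weyl function `m` that is meromorphic in the plane with
poles at the distinct real points `lam n`: off the real axis, the solution `θ + m φ` is square-summable
and its norm is determined by the imaginary part of `m`. -/
structure MeromorphicWeyl (p d : ℤ → ℝ) (φ θ : ℂ → ℤ → ℂ) (m : ℂ → ℂ) (lam : ℕ → ℝ) : Prop
    extends RegularFrame p d φ θ where
  mem_sol : ∀ z : ℂ, z.im ≠ 0 → Memℓp (sol φ θ z (m z)) 2
  norm_sol : ∀ z : ℂ, z.im ≠ 0 → z.im * ‖toL2 (sol φ θ z (m z))‖ ^ 2 = -(m z).im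
  injective : Function.Injective lam
  analytic : ∀ z : ℂ, (∀ n, z ≠ (lam n : ℂ)) → AnalyticAt ℂ m z
  pole : ∀ n, meromorphicOrderAt m (lam n : ℂ) < 0

namespace MeromorphicWeyl

variable {p d : ℤ → ℝ} {φ θ : ℂ → ℤ → ℂ} {m : ℂ → ℂ} {lam : ℕ → ℝ}

lemma analyticAt (h : MeromorphicWeyl p d φ θ m lam) {z : ℂ} (hz : z ∈ regularSet lam) :
    AnalyticAt ℂ m z :=
  h.analytic z fun n hn => hz ⟨n, hn.symm⟩

lemma mem_regularSet_of_analyticAt (h : MeromorphicWeyl p d φ θ m lam) {z : ℂ}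
    (hz : AnalyticAt ℂ m z) : z ∈ regularSet lam := by
  rintro ⟨n, rfl⟩
  exact absurd hz.meromorphicOrderAt_nonneg (not_le.2 (h.pole n))

lemma mem_regularSet_of_im_ne {z : ℂ} (hz : z.im ≠ 0) : z ∈ regularSet lam := by
  rintro ⟨n, rfl⟩
  simp at hz

lemma isOpen_regularSet (h : MeromorphicWeyl p d φ θ m lam) : IsOpen (regularSet lam) := by
  rw [isOpen_iff_eventually]
  intro z hz
  exact (h.analyticAt hz).eventually_analyticAt.mono fun w hw =>
    h.mem_regularSet_of_analyticAt hw

lemma isPreconnected_regularSet : IsPreconnected (regularSet lam) :=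
  ((Set.countable_range _).isConnected_compl_of_one_lt_rank (by simp)).isPreconnected

lemma exists_real_mem_regularSet : ∃ x : ℝ, (x : ℂ) ∈ regularSet lam := by
  obtain ⟨x, hx⟩ := ((Set.countable_range lam).dense_compl ℝ).nonempty
  refine ⟨x, ?_⟩
  rintro ⟨n, hn⟩
  exact hx ⟨n, Complex.ofReal_injective hn⟩

lemma eventually_regular (h : MeromorphicWeyl p d φ θ m lam) (n : ℕ) :
    ∀ᶠ z in 𝓝[≠] (lam n : ℂ), z ∈ regularSet lam :=
  (meromorphicAt_of_meromorphicOrderAt_ne_zero (h.pole n).ne).eventually_analyticAt.mono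
    fun _ hz => h.mem_regularSet_of_analyticAt hz

lemma im_nonpos (h : MeromorphicWeyl p d φ θ m lam) {z : ℂ} (hz : 0 < z.im) : (m z).im ≤ 0 := by
  have := h.norm_sol z hz.ne'
  have : 0 ≤ z.im * ‖toL2 (sol φ θ z (m z))‖ ^ 2 := by positivity
  linarith

lemma im_nonneg (h : MeromorphicWeyl p d φ θ m lam) {z : ℂ} (hz : z.im < 0) : 0 ≤ (m z).im := by
  have := h.norm_sol z hz.ne
  have : z.im * ‖toL2 (sol φ θ z (m z))‖ ^ 2 ≤ 0 :=
    mul_nonpos_of_nonpos_of_nonneg hz.le (by positivity)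
  linarith

/-- `m` is real on the real axis, as its imaginary part has opposite signs in the two
half-planes. -/
lemma im_eq_zero (h : MeromorphicWeyl p d φ θ m lam) {x : ℝ} (hx : (x : ℂ) ∈ regularSet lam) :
    (m x).im = 0 := by
  have hc : ContinuousAt (fun z => (m z).im) (x : ℂ) :=
    Complex.continuous_im.continuousAt.comp (h.analyticAt hx).continuousAt
  have ht : ∀ s : ℝ, Tendsto (fun t : ℝ => (m (x + s * t * Complex.I)).im) (𝓝[>] 0)
      (𝓝 (m x).im) := fun s => by
    refine hc.tendsto.comp ?_
    have : Continuous fun t : ℝ => (x : ℂ) + s * t * Complex.I := by fun_prop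
    simpa using (this.tendsto 0).mono_left nhdsWithin_le_nhds
  refine le_antisymm (le_of_tendsto (ht 1) ?_) (ge_of_tendsto (ht (-1)) ?_)
  · filter_upwards [self_mem_nhdsWithin] with t ht
    exact h.im_nonpos (by simpa using ht)
  · filter_upwards [self_mem_nhdsWithin] with t ht
    exact h.im_nonneg (by simpa using ht)

lemma conj_mem_regularSet {z : ℂ} (hz : z ∈ regularSet lam) : conj z ∈ regularSet lam := by
  rintro ⟨n, hn⟩
  refine hz ⟨n, ?_⟩
  have := congrArg (starRingEnd ℂ) hn
  simpa using this

lemma m_conj (h : MeromorphicWeyl p d φ θ m lam) {z : ℂ} (hz : z ∈ regularSet lam) :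
    m (conj z) = conj (m z) := by
  obtain ⟨x, hx⟩ := exists_real_mem_regularSet (lam := lam)
  have h1 := eqOn_zero_of_real (f := fun z => m z - conj (m (conj z))) h.isOpen_regularSet
    isPreconnected_regularSet (fun z hz => ?_) hx (fun y hy => ?_) (conj z)
    (conj_mem_regularSet hz)
  · simpa [sub_eq_zero] using h1
  · refine (h.analyticAt hz).differentiableAt.sub ?_
    have := (h.analyticAt (conj_mem_regularSet hz)).differentiableAt.conj_conj
    simpa [Function.comp_def] using this
  · have := h.im_eq_zero hy
    rw [Complex.conj_ofReal, Complex.conj_eq_iff_im.2 this, sub_self]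

lemma differentiableAt_sol (h : MeromorphicWeyl p d φ θ m lam) {z : ℂ} (hz : z ∈ regularSet lam)
    (n : ℤ) : DifferentiableAt ℂ (fun z => sol φ θ z (m z) n) z :=
  (h.differentiable_θ n z).add ((h.analyticAt hz).differentiableAt.mul (h.differentiable_φ n z))

/-- The Weyl solution `θ + m φ` as an element of `ℓ²(ℤ)`. -/
def weyl (φ θ : ℂ → ℤ → ℂ) (m : ℂ → ℂ) (z : ℂ) : SeqL2 := toL2 (sol φ θ z (m z))

lemma norm_weyl_sq (h : MeromorphicWeyl p d φ θ m lam) {z : ℂ} (hz : z.im ≠ 0) :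
    ‖weyl φ θ m z‖ ^ 2 = -(m z).im / z.im := by
  rw [eq_div_iff hz, mul_comm]
  exact h.norm_sol z hz

lemma weyl_bound (h : MeromorphicWeyl p d φ θ m lam) {c : ℂ} (hc : c ∈ regularSet lam) :
    ∃ M : ℝ, ∀ᶠ z in 𝓝 c, z.im ≠ 0 → ‖weyl φ θ m z‖ ≤ M := by
  by_cases him : c.im = 0
  · obtain ⟨x, rfl⟩ : ∃ x : ℝ, (x : ℂ) = c := ⟨c.re, by apply Complex.ext <;> simp [him]⟩
    have hr : ∀ᶠ y : ℝ in 𝓝 x, (m y).im = 0 :=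
      ((Complex.continuous_ofReal.tendsto x).eventually
        (h.isOpen_regularSet.mem_nhds hc)).mono fun y hy => h.im_eq_zero hy
    obtain ⟨K, hK, R, hR, hb⟩ := exists_im_le (h.analyticAt hc) hr
    refine ⟨Real.sqrt K, ?_⟩
    filter_upwards [Metric.ball_mem_nhds _ hR] with z hz hzi
    apply Real.le_sqrt_of_sq_le
    rw [h.norm_weyl_sq hzi]
    refine (le_abs_self _).trans ?_
    rw [abs_div, abs_neg, div_le_iff₀ (abs_pos.2 hzi)]
    exact hb z hz
  · have hcont : ContinuousAt (fun z => -(m z).im / z.im) c :=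
      ((Complex.continuous_im.continuousAt.comp (h.analyticAt hc).continuousAt).neg).div
        Complex.continuous_im.continuousAt him
    refine ⟨Real.sqrt (-(m c).im / c.im + 1), ?_⟩
    filter_upwards [hcont.eventually (gt_mem_nhds (lt_add_one _))] with z hz hzi
    apply Real.le_sqrt_of_sq_le
    rw [h.norm_weyl_sq hzi]
    exact hz.le

lemma weyl_regular (h : MeromorphicWeyl p d φ θ m lam) {c : ℂ} (hc : c ∈ regularSet lam) :
    Memℓp (sol φ θ c (m c)) 2 ∧ DifferentiableAt ℂ (weyl φ θ m) c := by
  obtain ⟨M, hM⟩ := h.weyl_bound hc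
  obtain ⟨R, hR, hb⟩ := Metric.eventually_nhds_iff_ball.1
    (hM.and (h.isOpen_regularSet.mem_nhds hc))
  have := memℓp_and_differentiableAt_of_nonreal (M := M) (u := fun z => sol φ θ z (m z)) hR
    (fun n z hz => (h.differentiableAt_sol (hb z hz).2 n).differentiableWithinAt)
    (fun z hz hzi => ⟨h.mem_sol z hzi, (hb z hz).1 hzi⟩)
  exact ⟨this.1 c (Metric.mem_ball_self hR), this.2⟩

lemma weyl_apply (h : MeromorphicWeyl p d φ θ m lam) {z : ℂ} (hz : z ∈ regularSet lam) (n : ℤ) :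
    weyl φ θ m z n = θ z n + m z * φ z n :=
  toL2_apply (h.weyl_regular hz).1 n

/-! ### The resolvent identity for the Weyl solutions -/

lemma differentiableAt_defect (h : MeromorphicWeyl p d φ θ m lam) {a b : ℂ → ℂ} {t : ℂ}
    (ha : DifferentiableAt ℂ a t) (hb : DifferentiableAt ℂ b t) (hat : a t ∈ regularSet lam)
    (hbt : b t ∈ regularSet lam) :
    DifferentiableAt ℂ (fun t => m (a t) - m (b t)
      + (a t - b t) * pair (weyl φ θ m (a t)) (weyl φ θ m (b t))) t := by
  have hma := (h.analyticAt hat).differentiableAt.comp t ha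
  have hmb := (h.analyticAt hbt).differentiableAt.comp t hb
  have hua := (h.weyl_regular hat).2.comp t ha
  have hub := (h.weyl_regular hbt).2.comp t hb
  have hp : DifferentiableAt ℂ (fun t => pair (weyl φ θ m (a t)) (weyl φ θ m (b t))) t :=
    (pair.differentiableAt.comp t hua).clm_apply hub
  exact (hma.sub hmb).add ((ha.sub hb).mul hp)

lemma defect_conj (h : MeromorphicWeyl p d φ θ m lam) {z : ℂ} (hz : z.im ≠ 0) :
    m z - m (conj z) + (z - conj z) * pair (weyl φ θ m z) (weyl φ θ m (conj z)) = 0 := by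
  have hr := mem_regularSet_of_im_ne (lam := lam) hz
  rw [pair_conj_self (x := weyl φ θ m z), h.m_conj hr, Complex.sub_conj, Complex.sub_conj]
  · have := h.norm_sol z hz
    change z.im * ‖weyl φ θ m z‖ ^ 2 = _ at this
    have h2 : ((z.im * ‖weyl φ θ m z‖ ^ 2 : ℝ) : ℂ) = ((-(m z).im : ℝ) : ℂ) := by rw [this]
    push_cast at h2 ⊢
    linear_combination 2 * Complex.I * h2
  · intro n
    rw [h.weyl_apply hr, h.weyl_apply (conj_mem_regularSet hr), h.m_conj hr]
    simp [h.conj_φ, h.conj_θ]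

/-- The pairing of two Weyl solutions. For conjugate parameters this is the formula for the norm,
and it extends to all parameters by the identity theorem, applied twice. Equivalently, the
Wronskian of two Weyl solutions vanishes at `-∞`. -/
lemma pair_weyl (h : MeromorphicWeyl p d φ θ m lam) {z z' : ℂ} (hz : z ∈ regularSet lam)
    (hz' : z' ∈ regularSet lam) :
    (z - z') * pair (weyl φ θ m z) (weyl φ θ m z') = m z' - m z := by
  set T : ℂ → ℂ → ℂ := fun z z' =>
    m z - m z' + (z - z') * pair (weyl φ θ m z) (weyl φ θ m z') with hT
  -- parameters `s + i t`, `s - i t` with real `s`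
  have h1 : ∀ (s : ℝ) (t : ℂ), 0 < t.re → T (s + Complex.I * t) (s - Complex.I * t) = 0 := by
    intro s t ht
    refine eqOn_zero_of_real (f := fun t => T (s + Complex.I * t) (s - Complex.I * t))
      (D := {t : ℂ | 0 < t.re}) (isOpen_lt continuous_const Complex.continuous_re)
      (convex_halfSpace_re_gt 0).isPreconnected (fun t ht => ?_) (x := 1) (by simp)
      (fun y hy => ?_) t ht
    · refine h.differentiableAt_defect (by fun_prop) (by fun_prop) ?_ ?_
      · exact mem_regularSet_of_im_ne (by simpa using ne_of_gt ht)
      · exact mem_regularSet_of_im_ne (by simpa using ne_of_gt ht)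
    · have hy' : 0 < y := by simpa using hy
      have := h.defect_conj (z := s + Complex.I * y) (by simpa using hy'.ne')
      rw [show conj ((s : ℂ) + Complex.I * y) = s - Complex.I * y by simp [sub_eq_add_neg]] at this
      exact this
  have h2 : ∀ s t : ℂ, |s.im| < t.re → T (s + Complex.I * t) (s - Complex.I * t) = 0 := by
    intro s t hst
    have ht : 0 < t.re := (abs_nonneg _).trans_lt hst
    have hD : {s : ℂ | |s.im| < t.re} = {s : ℂ | -t.re < s.im} ∩ {s : ℂ | s.im < t.re} := by
      ext s
      exact abs_lt (a := s.im)
    refine eqOn_zero_of_real (f := fun s => T (s + Complex.I * t) (s - Complex.I * t))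
      (D := {s : ℂ | |s.im| < t.re}) (isOpen_lt (by fun_prop) continuous_const)
      (by
        rw [hD]
        exact ((convex_halfSpace_im_gt _).inter (convex_halfSpace_im_lt _)).isPreconnected)
      (fun s hs => ?_) (x := 0) (by simpa using ht) (fun y _ => h1 y t ht) s hst
    have hs' := abs_lt.1 (show |s.im| < t.re from hs)
    refine h.differentiableAt_defect (by fun_prop) (by fun_prop) ?_ ?_
    · refine mem_regularSet_of_im_ne (ne_of_gt ?_)
      simp; linarith
    · refine mem_regularSet_of_im_ne (ne_of_lt ?_)
      simp; linarith
  have h3 : ∀ z z' : ℂ, 0 < z.im → z'.im < 0 → T z z' = 0 := by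
    intro z z' hz hz'
    have := h2 ((z + z') / 2) (-Complex.I * (z - z') / 2) (by
      simp only [Complex.div_ofNat_im, Complex.add_im, Complex.div_ofNat_re, Complex.mul_re,
        Complex.neg_re, Complex.I_re, Complex.neg_im, Complex.I_im, Complex.sub_re, Complex.sub_im]
      rw [abs_lt]
      constructor <;> linarith)
    have e1 : (z + z') / 2 + Complex.I * (-Complex.I * (z - z') / 2) = z := by
      linear_combination -(z - z') / 2 * Complex.I_sq
    have e2 : (z + z') / 2 - Complex.I * (-Complex.I * (z - z') / 2) = z' := by
      linear_combination (z - z') / 2 * Complex.I_sq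
    rwa [e1, e2] at this
  have cross : ∀ (f : ℂ → ℂ) (w : ℂ) (V : Set ℂ), IsOpen V → w ∈ V → w ∈ regularSet lam →
      (∀ z ∈ regularSet lam, DifferentiableAt ℂ f z) → (∀ z ∈ V, f z = 0) →
      ∀ z ∈ regularSet lam, f z = 0 := by
    intro f w V hV hwV hw hf h0
    have ha : AnalyticOnNhd ℂ f (regularSet lam) := DifferentiableOn.analyticOnNhd
      (fun z hz => (hf z hz).differentiableWithinAt) h.isOpen_regularSet
    exact ha.eqOn_zero_of_preconnected_of_eventuallyEq_zero isPreconnected_regularSet hw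
      (by filter_upwards [hV.mem_nhds hwV] with z hz using h0 z hz)
  have h4 : ∀ z ∈ regularSet lam, ∀ z' : ℂ, z'.im < 0 → T z z' = 0 := by
    intro z hz z' hz'
    refine cross (fun z => T z z') Complex.I {z : ℂ | 0 < z.im}
      (isOpen_lt continuous_const Complex.continuous_im) (by simp)
      (mem_regularSet_of_im_ne (by simp)) (fun z hz => ?_) (fun z hz => h3 z z' hz hz') z hz
    exact h.differentiableAt_defect differentiableAt_id (differentiableAt_const z') hz
      (mem_regularSet_of_im_ne hz'.ne)
  have h5 : T z z' = 0 := by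
    refine cross (fun z' => T z z') (-Complex.I) {z : ℂ | z.im < 0}
      (isOpen_lt Complex.continuous_im continuous_const) (by simp)
      (mem_regularSet_of_im_ne (by simp)) (fun w hw => ?_) (fun w hw => h4 z hz w hw) z' hz'
    exact h.differentiableAt_defect (differentiableAt_const z) differentiableAt_id hz hw
  simp only [hT] at h5
  linear_combination h5

/-! ### Eigenfunctions at the poles -/

lemma eventually_ne_zero (h : MeromorphicWeyl p d φ θ m lam) (n : ℕ) :
    ∀ᶠ z in 𝓝[≠] (lam n : ℂ), m z ≠ 0 :=
  (tendsto_cobounded_of_meromorphicOrderAt_neg (h.pole n)).eventually_ne_cobounded 0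

lemma tendsto_inv (h : MeromorphicWeyl p d φ θ m lam) (n : ℕ) :
    Tendsto (fun z => (m z)⁻¹) (𝓝[≠] (lam n : ℂ)) (𝓝 0) :=
  tendsto_inv₀_cobounded.comp (tendsto_cobounded_of_meromorphicOrderAt_neg (h.pole n))

/-- Near a pole, the renormalized Weyl solutions `m⁻¹ θ + φ` stay bounded, since `1 / m` extends to
a holomorphic function that is real on the real axis; so they converge in norm to the
eigenfunction `φ`. -/
lemma pole_tendsto (h : MeromorphicWeyl p d φ θ m lam) (n : ℕ) :
    Memℓp (φ (lam n)) 2 ∧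
    Tendsto (fun z => (m z)⁻¹ • weyl φ θ m z) (𝓝[≠] (lam n : ℂ)) (𝓝 (toL2 (φ (lam n)))) := by
  classical
  set A : ℂ → ℂ := Function.update (fun z => (m z)⁻¹) (lam n : ℂ) 0 with hAdef
  have hA0 : A (lam n) = 0 := by simp [hAdef]
  have hAne : ∀ z, z ≠ (lam n : ℂ) → A z = (m z)⁻¹ := fun z hz => by simp [hAdef, hz]
  have hA : AnalyticAt ℂ A (lam n : ℂ) := by
    refine AnalyticAt.of_meromorphicOrderAt_pos ?_ hA0
    have e : meromorphicOrderAt A (lam n : ℂ) = meromorphicOrderAt m⁻¹ (lam n : ℂ) :=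
      meromorphicOrderAt_congr (by
        filter_upwards [self_mem_nhdsWithin] with z hz using hAne z hz)
    rw [e, meromorphicOrderAt_inv]
    have := h.pole n
    cases ho : meromorphicOrderAt m (lam n : ℂ) with
    | top => rw [ho] at this; simp at this
    | coe k =>
      rw [ho] at this
      have hk : k < 0 := by exact_mod_cast this
      have : (0 : WithTop ℤ) < ((-k : ℤ) : WithTop ℤ) := by exact_mod_cast neg_pos.2 hk
      simpa using this
  have hreg : ∀ᶠ z in 𝓝 (lam n : ℂ), z ≠ (lam n : ℂ) → z ∈ regularSet lam ∧ m z ≠ 0 :=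
    eventually_nhdsWithin_iff.1 ((h.eventually_regular n).and (h.eventually_ne_zero n))
  have hr : ∀ᶠ y : ℝ in 𝓝 (lam n), (A y).im = 0 := by
    filter_upwards [(Complex.continuous_ofReal.tendsto (lam n)).eventually hreg] with y hy
    by_cases hyn : (y : ℂ) = lam n
    · rw [hyn, hA0]; simp
    · rw [hAne _ hyn, Complex.inv_im, h.im_eq_zero (hy hyn).1]; simp
  obtain ⟨K, hK, R₁, hR₁, hb⟩ := exists_im_le hA hr
  obtain ⟨R₂, hR₂, hb₂⟩ := Metric.eventually_nhds_iff_ball.1 (hreg.and hA.eventually_analyticAt)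
  have hsub1 : Metric.ball (lam n : ℂ) (min R₁ R₂) ⊆ Metric.ball (lam n : ℂ) R₁ :=
    Metric.ball_subset_ball (min_le_left _ _)
  have hsub2 : Metric.ball (lam n : ℂ) (min R₁ R₂) ⊆ Metric.ball (lam n : ℂ) R₂ :=
    Metric.ball_subset_ball (min_le_right _ _)
  set χ : ℂ → ℤ → ℂ := fun z k => A z * θ z k + φ z k with hχ
  have hχn : χ (lam n) = φ (lam n) := by
    funext k; simp [hχ, hA0]
  have hχne : ∀ z, z ≠ (lam n : ℂ) → m z ≠ 0 → χ z = (m z)⁻¹ • sol φ θ z (m z) := by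
    intro z hz hmz
    funext k
    simp only [hχ, hAne z hz, sol, Pi.smul_apply, smul_eq_mul]
    field_simp
  have key := memℓp_and_differentiableAt_of_nonreal (u := χ) (M := Real.sqrt K)
    (lt_min hR₁ hR₂)
    (fun k z hz => ((((hb₂ z (hsub2 hz)).2.differentiableAt).mul (h.differentiable_θ k z)).add
      (h.differentiable_φ k z)).differentiableWithinAt) (fun z hz hzi => by
      have hzn : z ≠ (lam n : ℂ) := by rintro rfl; simp at hzi
      have hmz := ((hb₂ z (hsub2 hz)).1 hzn).2
      rw [hχne z hzn hmz]
      refine ⟨(h.mem_sol z hzi).const_smul _, ?_⟩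
      rw [toL2_smul _ (h.mem_sol z hzi)]
      apply Real.le_sqrt_of_sq_le
      rw [norm_smul, mul_pow]
      have e1 := h.norm_weyl_sq hzi
      rw [weyl] at e1
      have e2 : ‖(m z)⁻¹‖ ^ 2 * (-(m z).im / z.im) = (A z).im / z.im := by
        rw [hAne z hzn, Complex.inv_im, norm_inv, Complex.normSq_eq_norm_sq]
        field_simp
      rw [e1, e2]
      refine (le_abs_self _).trans ?_
      rw [abs_div, div_le_iff₀ (abs_pos.2 hzi)]
      exact hb z (hsub1 hz))
  have hmem := key.1 (lam n) (Metric.mem_ball_self (lt_min hR₁ hR₂))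
  rw [hχn] at hmem
  refine ⟨hmem, ?_⟩
  have hcont := key.2.continuousAt.tendsto
  rw [hχn] at hcont
  refine (hcont.mono_left nhdsWithin_le_nhds).congr' ?_
  filter_upwards [h.eventually_regular n, h.eventually_ne_zero n, self_mem_nhdsWithin]
    with z hz hmz hzn
  rw [hχne z hzn hmz, toL2_smul _ (h.weyl_regular hz).1, weyl]

/-- The eigenfunction `φ (lam n)` as an element of `ℓ²(ℤ)`. -/
def eigenvec (φ : ℂ → ℤ → ℂ) (lam : ℕ → ℝ) (n : ℕ) : SeqL2 := toL2 (φ (lam n))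

lemma eigenvec_apply (h : MeromorphicWeyl p d φ θ m lam) (n : ℕ) (k : ℤ) :
    eigenvec φ lam n k = φ (lam n) k :=
  toL2_apply (h.pole_tendsto n).1 k

lemma tendsto_pair_eigenvec (h : MeromorphicWeyl p d φ θ m lam) (n : ℕ) (y : SeqL2) :
    Tendsto (fun z => (m z)⁻¹ * pair (weyl φ θ m z) y) (𝓝[≠] (lam n : ℂ))
      (𝓝 (pair (eigenvec φ lam n) y)) := by
  have := ((pair.flip y).continuous.tendsto _).comp (h.pole_tendsto n).2
  refine this.congr fun z => ?_
  simp

lemma pair_eigenvec_weyl (h : MeromorphicWeyl p d φ θ m lam) (n : ℕ) {z : ℂ}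
    (hz : z ∈ regularSet lam) :
    (lam n - z) * pair (eigenvec φ lam n) (weyl φ θ m z) = -1 := by
  have h1 : Tendsto (fun w : ℂ => (w - z) * ((m w)⁻¹ * pair (weyl φ θ m w) (weyl φ θ m z)))
      (𝓝[≠] (lam n : ℂ)) (𝓝 ((lam n - z) * pair (eigenvec φ lam n) (weyl φ θ m z))) := by
    have hc : Tendsto (fun w : ℂ => w - z) (𝓝[≠] (lam n : ℂ)) (𝓝 (lam n - z)) :=
      (tendsto_id.mono_left nhdsWithin_le_nhds).sub_const z
    exact hc.mul (h.tendsto_pair_eigenvec n _)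
  have h2 : Tendsto (fun w : ℂ => m z * (m w)⁻¹ - 1) (𝓝[≠] (lam n : ℂ)) (𝓝 (-1)) := by
    simpa using ((h.tendsto_inv n).const_mul (m z)).sub_const 1
  refine tendsto_nhds_unique h1 (h2.congr' ?_)
  filter_upwards [h.eventually_regular n, h.eventually_ne_zero n] with w hw hmw
  have := h.pair_weyl hw hz
  field_simp
  linear_combination -this

lemma pair_eigenvec_of_ne (h : MeromorphicWeyl p d φ θ m lam) {n k : ℕ} (hnk : n ≠ k) :
    pair (eigenvec φ lam n) (eigenvec φ lam k) = 0 := by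
  have h1 : Tendsto (fun w : ℂ => (lam n - w) * ((m w)⁻¹ * pair (weyl φ θ m w) (eigenvec φ lam n)))
      (𝓝[≠] (lam k : ℂ)) (𝓝 ((lam n - lam k) * pair (eigenvec φ lam k) (eigenvec φ lam n))) := by
    have hc : Tendsto (fun w : ℂ => lam n - w) (𝓝[≠] (lam k : ℂ)) (𝓝 (lam n - lam k)) :=
      (tendsto_id.mono_left nhdsWithin_le_nhds).const_sub _
    exact hc.mul (h.tendsto_pair_eigenvec k _)
  have h2 : Tendsto (fun w : ℂ => -(m w)⁻¹) (𝓝[≠] (lam k : ℂ)) (𝓝 0) := by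
    simpa using (h.tendsto_inv k).neg
  have h3 : ((lam n : ℂ) - lam k) * pair (eigenvec φ lam k) (eigenvec φ lam n) = 0 := by
    refine tendsto_nhds_unique h1 (h2.congr' ?_)
    filter_upwards [h.eventually_regular k] with w hw
    have := h.pair_eigenvec_weyl n hw
    rw [pair_comm] at this
    linear_combination -(m w)⁻¹ * this
  rw [pair_comm]
  refine (mul_eq_zero.1 h3).resolve_left (sub_ne_zero.2 fun e => hnk ?_)
  exact h.injective (Complex.ofReal_injective e)

lemma eigenvec_conj (h : MeromorphicWeyl p d φ θ m lam) (n : ℕ) (k : ℤ) :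
    conj (eigenvec φ lam n k) = eigenvec φ lam n k := by
  rw [h.eigenvec_apply, h.conj_φ, Complex.conj_ofReal]

lemma pair_eigenvec_self (h : MeromorphicWeyl p d φ θ m lam) (n : ℕ) :
    pair (eigenvec φ lam n) (eigenvec φ lam n) = ((‖eigenvec φ lam n‖ ^ 2 : ℝ) : ℂ) :=
  pair_conj_self fun k => (h.eigenvec_conj n k).symm

lemma eigenvec_ne_zero (h : MeromorphicWeyl p d φ θ m lam) (n : ℕ) : eigenvec φ lam n ≠ 0 := by
  intro h0
  have hz : ∀ k, φ (lam n) k = 0 := fun k => by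
    rw [← h.eigenvec_apply, h0]; rfl
  have := h.wr_eq_one (lam n) 0
  simp [wr, hz] at this

/-- The poles are simple, and the residue is the inverse squared norm of the eigenfunction. -/
lemma tendsto_residue (h : MeromorphicWeyl p d φ θ m lam) (n : ℕ) :
    Tendsto (fun z => (z - lam n) * m z) (𝓝[≠] (lam n : ℂ))
      (𝓝 (((‖eigenvec φ lam n‖ ^ 2 : ℝ) : ℂ)⁻¹)) := by
  have hne : ((‖eigenvec φ lam n‖ ^ 2 : ℝ) : ℂ) ≠ 0 := by
    simpa using h.eigenvec_ne_zero n
  have h1 := h.tendsto_pair_eigenvec n (eigenvec φ lam n)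
  rw [h.pair_eigenvec_self] at h1
  refine (h1.inv₀ hne).congr' ?_
  filter_upwards [h.eventually_regular n, h.eventually_ne_zero n, self_mem_nhdsWithin]
    with z hz hmz hzn
  have := h.pair_eigenvec_weyl n hz
  rw [pair_comm] at this
  have hzn' : z - lam n ≠ 0 := sub_ne_zero.2 hzn
  have h3 : pair (weyl φ θ m z) (eigenvec φ lam n) = (z - lam n)⁻¹ := by
    field_simp
    linear_combination -this
  rw [h3, mul_inv, inv_inv, inv_inv, mul_comm]

lemma residue_eq (h : MeromorphicWeyl p d φ θ m lam) {n : ℕ} {r : ℂ}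
    (hr : HasResidueAt m (lam n : ℂ) r) : r = ((‖eigenvec φ lam n‖ ^ 2 : ℝ) : ℂ)⁻¹ := by
  obtain ⟨N, a, g, hg, ha, hm⟩ := hr
  set c : ℂ := (lam n : ℂ)
  -- `(z - c) m(z)` is, up to `o(1)`, a polynomial in `(z - c)⁻¹` with a finite limit
  set P : Polynomial ℂ := ∑ k ∈ Finset.range (N + 1), Polynomial.C (a k) * Polynomial.X ^ k with hP
  have hsub : Tendsto (fun z => z - c) (𝓝[≠] c) (𝓝[≠] 0) := by
    refine tendsto_nhdsWithin_iff.2 ⟨?_, ?_⟩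
    · have : Continuous fun z : ℂ => z - c := by fun_prop
      simpa using (this.tendsto c).mono_left nhdsWithin_le_nhds
    · filter_upwards [self_mem_nhdsWithin] with z hz using sub_ne_zero.2 hz
  have hlim : Tendsto (fun z => P.eval (z - c)⁻¹) (𝓝[≠] c)
      (𝓝 (((‖eigenvec φ lam n‖ ^ 2 : ℝ) : ℂ)⁻¹)) := by
    have h1 : Tendsto (fun z => (z - c) * g z) (𝓝[≠] c) (𝓝 0) := by
      simpa using (hsub.mono_right nhdsWithin_le_nhds).mul
        (hg.continuousAt.tendsto.mono_left nhdsWithin_le_nhds)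
    have h2 := (h.tendsto_residue n).sub h1
    rw [sub_zero] at h2
    refine h2.congr' ?_
    filter_upwards [hm, self_mem_nhdsWithin] with z hz hzc
    have hzc' : z - c ≠ 0 := sub_ne_zero.2 hzc
    rw [hz, mul_add, add_sub_cancel_left, hP, Polynomial.eval_finsetSum, Finset.mul_sum]
    refine Finset.sum_congr rfl fun k _ => ?_
    simp only [Polynomial.eval_mul, Polynomial.eval_C, Polynomial.eval_pow, Polynomial.eval_X]
    rw [inv_pow, pow_succ]
    change (z - c) * (a k / ((z - c) ^ k * (z - c))) = a k * ((z - c) ^ k)⁻¹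
    field_simp
  have hdeg : ¬ 0 < P.degree := fun hdeg => by
    have h1 : Tendsto (fun z => ‖(z - c)⁻¹‖) (𝓝[≠] c) atTop :=
      tendsto_norm_cobounded_atTop.comp (tendsto_inv₀_nhdsNE_zero.comp hsub)
    exact not_tendsto_nhds_of_tendsto_atTop (Polynomial.tendsto_norm_atTop P hdeg h1) _ hlim.norm
  rw [Polynomial.eq_C_of_degree_le_zero (not_lt.1 hdeg)] at hlim
  simp only [Polynomial.eval_C] at hlim
  have h0 : P.coeff 0 = a 0 := by
    rw [hP, Polynomial.finsetSum_coeff, Finset.sum_eq_single 0]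
    · simp
    · intro k _ hk
      simp [Polynomial.coeff_X_pow, hk.symm]
    · simp
  rw [← ha, ← h0]
  exact tendsto_nhds_unique tendsto_const_nhds hlim

end MeromorphicWeyl

/-! ### Completeness of the eigenfunctions -/

/-- An entire function bounded by `C / |Im z|` vanishes: on the circle `|z| = R` one has
`|z ^ 2 - R ^ 2| = 2 R |Im z|`, so the maximum principle applies to `(z ^ 2 - R ^ 2) F(z)`. -/
lemma eq_zero_of_im_mul_le {F : ℂ → ℂ} (hF : Differentiable ℂ F) {C : ℝ}
    (hC : ∀ z : ℂ, z.im ≠ 0 → |z.im| * ‖F z‖ ≤ C) (w : ℂ) : F w = 0 := by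
  have hC0 : 0 ≤ C := (by positivity : 0 ≤ |Complex.I.im| * ‖F Complex.I‖).trans
    (hC Complex.I (by simp))
  have key : ∀ R : ℝ, ‖w‖ < R → ‖(w ^ 2 - (R : ℂ) ^ 2) * F w‖ ≤ 2 * R * C := by
    intro R hR
    have hR0 : 0 < R := (norm_nonneg w).trans_lt hR
    refine Complex.norm_le_of_forall_mem_frontier_norm_le (U := Metric.ball 0 R)
      (f := fun z => (z ^ 2 - (R : ℂ) ^ 2) * F z)
      Metric.isBounded_ball (Differentiable.diffContOnCl (by fun_prop)) (fun z hz => ?_)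
      (subset_closure (by simpa using hR))
    rw [frontier_ball _ hR0.ne', mem_sphere_zero_iff_norm] at hz
    have e : z ^ 2 - (R : ℂ) ^ 2 = z * (2 * z.im * Complex.I) := by
      have h1 : (R : ℂ) ^ 2 = z * conj z := by
        rw [Complex.mul_conj, Complex.normSq_eq_norm_sq, hz]; push_cast; ring
      have h2 := Complex.sub_conj z
      push_cast at h2
      rw [h1, ← h2]; ring
    rw [e, norm_mul, norm_mul, hz]
    simp only [norm_mul, Complex.norm_ofNat, Complex.norm_real, Complex.norm_I, mul_one,
      Real.norm_eq_abs]
    by_cases him : z.im = 0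
    · rw [him]; simp; positivity
    · have := hC z him
      calc R * (2 * |z.im|) * ‖F z‖ = 2 * R * (|z.im| * ‖F z‖) := by ring
        _ ≤ 2 * R * C := by gcongr
  by_contra hne
  have hf : 0 < ‖F w‖ := norm_pos_iff.2 hne
  set f := ‖F w‖ with hfdef
  set R : ℝ := 2 * ‖w‖ + 1 + 4 * C / f with hRdef
  have hq : 0 ≤ 4 * C / f := by positivity
  have hw := norm_nonneg w
  have hR : ‖w‖ < R := by rw [hRdef]; linarith
  have h1 := key R hR
  rw [norm_mul] at h1
  have h2 : R ^ 2 - ‖w‖ ^ 2 ≤ ‖w ^ 2 - (R : ℂ) ^ 2‖ := by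
    have := norm_sub_norm_le ((R : ℂ) ^ 2) (w ^ 2)
    rw [norm_sub_rev, norm_pow, norm_pow, Complex.norm_real, Real.norm_of_nonneg
      (hw.trans hR.le)] at this
    exact this
  have h3 : 3 / 4 * R ^ 2 ≤ R ^ 2 - ‖w‖ ^ 2 := by
    have : 2 * ‖w‖ ≤ R := by rw [hRdef]; linarith
    nlinarith
  have h4 : 3 / 4 * R ^ 2 * f ≤ 2 * R * C := by
    refine le_trans ?_ h1
    exact mul_le_mul_of_nonneg_right (h3.trans h2) hf.le
  have hR0 : 0 < R := hw.trans_lt hR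
  have h5 : 3 / 4 * (R * f) ≤ 2 * C := by
    by_contra hcon
    nlinarith
  have h6 : R * f = (2 * ‖w‖ + 1) * f + 4 * C := by
    rw [hRdef]; field_simp
  nlinarith

lemma pair_tail_sub {u : ℤ → ℂ} (hu : TailL2 u) (k : ℤ) (y : SeqL2) :
    pair (toL2 (tail k u)) y = pair (toL2 (tail (k + 1) u)) y + u k * y k := by
  have h1 := (hasSum_pair (toL2 (tail k u)) y).sub (hasSum_pair (toL2 (tail (k + 1) u)) y)
  have h2 := hasSum_single (f := fun n => (toL2 (tail k u) : ℤ → ℂ) n * y n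
    - (toL2 (tail (k + 1) u) : ℤ → ℂ) n * y n) k (fun n hn => by
      simp only [toL2_coe (hu _)]
      rcases lt_or_gt_of_ne hn with hlt | hgt
      · rw [tail_of_lt hlt, tail_of_lt (by omega)]; ring
      · rw [tail_of_le hgt.le, tail_of_le (by omega)]; ring)
  have h3 := h1.unique h2
  simp only [toL2_coe (hu _)] at h3
  rw [tail_of_le le_rfl, tail_of_lt (by omega)] at h3
  linear_combination h3

namespace MeromorphicWeyl

variable {p d : ℤ → ℝ} {φ θ : ℂ → ℤ → ℂ} {m : ℂ → ℂ} {lam : ℕ → ℝ}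

/-- Green's function: the `n`-th entry is `φ_k ψ_n` for `n ≤ k` and `ψ_k φ_n` for `n > k`, where
`ψ = θ + m φ`. In this form the only non-entire dependence on `z` is through the first summand. -/
def green (φ θ : ℂ → ℤ → ℂ) (m : ℂ → ℂ) (k : ℤ) (z : ℂ) : SeqL2 :=
  φ z k • weyl φ θ m z + (θ z k • toL2 (tail (k + 1) (φ z)) - φ z k • toL2 (tail (k + 1) (θ z)))

lemma green_apply (h : MeromorphicWeyl p d φ θ m lam) {z : ℂ} (hz : z ∈ regularSet lam)
    (k n : ℤ) : green φ θ m k z n = φ z k * (θ z n + m z * φ z n)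
      + (θ z k * tail (k + 1) (φ z) n - φ z k * tail (k + 1) (θ z) n) := by
  rw [green, ← h.weyl_apply hz, ← toL2_apply (h.tail_φ z (k + 1)),
    ← toL2_apply (h.tail_θ z (k + 1))]
  rfl

lemma green_of_le (h : MeromorphicWeyl p d φ θ m lam) {z : ℂ} (hz : z ∈ regularSet lam)
    {k n : ℤ} (hn : n ≤ k) : green φ θ m k z n = φ z k * sol φ θ z (m z) n := by
  rw [h.green_apply hz, tail_of_lt (by omega), tail_of_lt (by omega), sol]; ring

lemma green_of_gt (h : MeromorphicWeyl p d φ θ m lam) {z : ℂ} (hz : z ∈ regularSet lam)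
    {k n : ℤ} (hn : k < n) : green φ θ m k z n = sol φ θ z (m z) k * φ z n := by
  rw [h.green_apply hz, tail_of_le (by omega), tail_of_le (by omega), sol]; ring

lemma norm_green_sq (h : MeromorphicWeyl p d φ θ m lam) {z : ℂ} (hz : z.im ≠ 0) (k : ℤ) :
    z.im * ‖green φ θ m k z‖ ^ 2 = -(φ z k * sol φ θ z (m z) k).im := by
  have hr := mem_regularSet_of_im_ne (lam := lam) hz
  have hm := h.mem_sol z hz
  have hsum : ‖green φ θ m k z‖ ^ 2 = ‖φ z k‖ ^ 2 * (‖toL2 (sol φ θ z (m z))‖ ^ 2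
      - ‖toL2 (tail (k + 1) (sol φ θ z (m z)))‖ ^ 2)
      + ‖sol φ θ z (m z) k‖ ^ 2 * ‖toL2 (tail (k + 1) (φ z))‖ ^ 2 := by
    refine (hasSum_norm_sq (green φ θ m k z)).unique ?_
    have h1 := (((hasSum_norm_sq (toL2 (sol φ θ z (m z)))).sub
      (hasSum_tail_norm (h.tail_sol z (m z)) (k + 1))).mul_left (‖φ z k‖ ^ 2)).add
      ((hasSum_tail_norm (h.tail_φ z) (k + 1)).mul_left (‖sol φ θ z (m z) k‖ ^ 2))
    refine h1.congr_fun fun n => ?_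
    rw [toL2_apply hm]
    by_cases hn : n ≤ k
    · rw [h.green_of_le hr hn, tail_of_lt (by omega), tail_of_lt (by omega), norm_mul]
      simp only [norm_zero]; ring
    · rw [h.green_of_gt hr (not_le.1 hn), tail_of_le (by omega), tail_of_le (by omega), norm_mul]
      ring
  have e1 := h.wr_sol_conj z (m z) (k + 1)
  have e2 := h.wr_φ_conj z (k + 1)
  have e3 := h.wr_φ_sol_eq z (m z) (k + 1)
  have e4 := congrArg (starRingEnd ℂ) e3
  rw [← wr_conj] at e4
  have e5 := h.norm_sol z hz
  have e6 : ((z.im * ‖toL2 (sol φ θ z (m z))‖ ^ 2 : ℝ) : ℂ) = ((-(m z).im : ℝ) : ℂ) := by rw [e5]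
  have n1 : ((‖φ z k‖ ^ 2 : ℝ) : ℂ) = φ z k * conj (φ z k) := by
    rw [Complex.mul_conj, Complex.normSq_eq_norm_sq]
  have n2 : ((‖sol φ θ z (m z) k‖ ^ 2 : ℝ) : ℂ)
      = sol φ θ z (m z) k * conj (sol φ θ z (m z) k) := by
    rw [Complex.mul_conj, Complex.normSq_eq_norm_sq]
  have n3 := Complex.sub_conj (φ z k * sol φ θ z (m z) k)
  have hfin : 2 * Complex.I * ((z.im * ‖green φ θ m k z‖ ^ 2 : ℝ) : ℂ)
      = 2 * Complex.I * ((-(φ z k * sol φ θ z (m z) k).im : ℝ) : ℂ) := by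
    rw [hsum]
    simp only [wr, add_sub_cancel_right, map_one] at e1 e2 e3 e4
    push_cast at e1 e2 e6 n1 n2 n3 ⊢
    rw [n1, n2]
    rw [map_mul] at n3
    linear_combination 2 * Complex.I * (φ z k * conj (φ z k)) * e6
      - sol φ θ z (m z) k * conj (sol φ θ z (m z) k) * e2
      + φ z k * conj (φ z k) * e1
      + conj (φ z k) * conj (sol φ θ z (m z) k) * e3
      - φ z k * sol φ θ z (m z) k * e4 - n3
  have h2 : (2 : ℂ) * Complex.I ≠ 0 := by simp
  exact Complex.ofReal_inj.1 (mul_left_cancel₀ h2 hfin)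

lemma norm_green_sq_le (h : MeromorphicWeyl p d φ θ m lam) {z : ℂ} (hz : z.im ≠ 0) (k : ℤ) :
    |z.im| * ‖green φ θ m k z‖ ^ 2 ≤ ‖φ z k * sol φ θ z (m z) k‖ := by
  have := h.norm_green_sq hz k
  have h1 : |z.im| * ‖green φ θ m k z‖ ^ 2 = |z.im * ‖green φ θ m k z‖ ^ 2| := by
    rw [abs_mul, abs_of_nonneg (by positivity : 0 ≤ ‖green φ θ m k z‖ ^ 2)]
  rw [h1, this, abs_neg]
  exact Complex.abs_im_le_norm _

lemma norm_green_le (h : MeromorphicWeyl p d φ θ m lam) {z : ℂ} (hz : z.im ≠ 0) (k : ℤ) :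
    |z.im| * ‖green φ θ m k z‖ ≤ 1 := by
  have h1 := h.norm_green_sq_le hz k
  rw [← h.green_of_le (mem_regularSet_of_im_ne hz) le_rfl] at h1
  have h2 := lp.norm_apply_le_norm two_ne_zero (green φ θ m k z) k
  by_contra hcon
  rw [not_le] at hcon
  have hpos : 0 < ‖green φ θ m k z‖ := by
    by_contra h0
    have : ‖green φ θ m k z‖ = 0 := le_antisymm (not_lt.1 h0) (norm_nonneg _)
    rw [this] at hcon
    linarith
  nlinarith

/-- The pairing of the Weyl solutions with a vector orthogonal to all eigenfunctions extends to an
entire function. -/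
lemma exists_entire (h : MeromorphicWeyl p d φ θ m lam) {y : SeqL2}
    (hy : ∀ n, pair (eigenvec φ lam n) y = 0) :
    ∃ Φ : ℂ → ℂ, Differentiable ℂ Φ ∧ ∀ z ∈ regularSet lam, Φ z = pair (weyl φ θ m z) y := by
  classical
  set f : ℂ → ℂ := fun z => pair (weyl φ θ m z) y with hf
  have hfd : ∀ z ∈ regularSet lam, DifferentiableAt ℂ f z := fun z hz =>
    (pair.flip y).differentiableAt.comp z (h.weyl_regular hz).2
  set Φ : ℂ → ℂ := fun z => if z ∈ regularSet lam then f z else limUnder (𝓝[≠] z) f with hΦ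
  have hΦr : ∀ z ∈ regularSet lam, Φ z = f z := fun z hz => by simp [hΦ, hz]
  refine ⟨Φ, fun z => ?_, hΦr⟩
  by_cases hz : z ∈ regularSet lam
  · refine (hfd z hz).congr_of_eventuallyEq ?_
    filter_upwards [h.isOpen_regularSet.mem_nhds hz] with w hw using hΦr w hw
  · obtain ⟨n, rfl⟩ : ∃ n, (lam n : ℂ) = z := by simpa [regularSet] using hz
    set c : ℂ := (lam n : ℂ)
    have hlim : Tendsto (fun z => (f z - f c) * (z - c)) (𝓝[≠] c) (𝓝 0) := by
      have h0 : Tendsto (fun z => z - c) (𝓝[≠] c) (𝓝 0) := by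
        have : Continuous fun z : ℂ => z - c := by fun_prop
        simpa using (this.tendsto c).mono_left nhdsWithin_le_nhds
      have h1 := (h.tendsto_residue n).mul (h.tendsto_pair_eigenvec n y)
      rw [hy n, mul_zero] at h1
      have h2 := h1.sub (h0.const_mul (f c))
      rw [mul_zero, sub_zero] at h2
      refine h2.congr' ?_
      filter_upwards [h.eventually_ne_zero n] with w hw
      change (w - c) * m w * ((m w)⁻¹ * f w) - f c * (w - c) = _
      field_simp
    have hd := Complex.differentiableOn_update_limUnder_insert_of_isLittleO (f := f) (c := c)
      (h.eventually_regular n) (fun z hz => (hfd z hz).differentiableWithinAt) (by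
        rw [Asymptotics.isLittleO_iff_tendsto']
        · simpa only [div_inv_eq_mul] using hlim
        · filter_upwards [self_mem_nhdsWithin] with w hw h0
          exact absurd h0 (inv_ne_zero (sub_ne_zero.2 hw)))
    have hnhds : insert c (regularSet lam) ∈ 𝓝 c :=
      insert_mem_nhds_iff.2 (h.eventually_regular n)
    refine (hd.differentiableAt hnhds).congr_of_eventuallyEq ?_
    filter_upwards [hnhds] with w hw
    by_cases hwc : w = c
    · subst hwc
      simp [hΦ, hz]
    · rw [Function.update_of_ne hwc]
      exact hΦr w ((Set.mem_insert_iff.1 hw).resolve_left hwc)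

/-- The eigenfunctions are complete: for a vector orthogonal to all of them, its image under the
resolvent is entire and decays off the real axis, hence vanishes. -/
lemma eq_zero_of_pair_eigenvec (h : MeromorphicWeyl p d φ θ m lam) {y : SeqL2}
    (hy : ∀ n, pair (eigenvec φ lam n) y = 0) : y = 0 := by
  obtain ⟨Φ, hΦ, hΦr⟩ := h.exists_entire hy
  have hI : Complex.I ∈ regularSet lam := mem_regularSet_of_im_ne (by simp)
  have hres : ∀ k, pair (green φ θ m k Complex.I) y = 0 := by
    intro k
    have hd : Differentiable ℂ fun z => φ z k * Φ z + (θ z k * pair (toL2 (tail (k + 1) (φ z))) y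
        - φ z k * pair (toL2 (tail (k + 1) (θ z))) y) := by
      have d1 := h.differentiable_tail h.eigen_φ h.tail_φ h.wr_φφ h.wr_φθ (k + 1)
      have d2 := h.differentiable_tail h.eigen_θ h.tail_θ h.wr_θφ h.wr_θθ (k + 1)
      have p1 : Differentiable ℂ fun z => pair (toL2 (tail (k + 1) (φ z))) y :=
        (pair.flip y).differentiable.comp d1
      have p2 : Differentiable ℂ fun z => pair (toL2 (tail (k + 1) (θ z))) y :=
        (pair.flip y).differentiable.comp d2
      exact ((h.differentiable_φ k).mul hΦ).add
        (((h.differentiable_θ k).mul p1).sub ((h.differentiable_φ k).mul p2))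
    have he : ∀ z ∈ regularSet lam, pair (green φ θ m k z) y = φ z k * Φ z +
        (θ z k * pair (toL2 (tail (k + 1) (φ z))) y
        - φ z k * pair (toL2 (tail (k + 1) (θ z))) y) := fun z hz => by
      rw [green, hΦr z hz]; simp
    rw [he _ hI]
    refine eq_zero_of_im_mul_le hd (C := ‖y‖) (fun z hz => ?_) Complex.I
    rw [← he z (mem_regularSet_of_im_ne hz)]
    calc |z.im| * ‖pair (green φ θ m k z) y‖ ≤ |z.im| * (‖green φ θ m k z‖ * ‖y‖) := by
          gcongr; exact norm_pair_le _ _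
      _ = (|z.im| * ‖green φ θ m k z‖) * ‖y‖ := by ring
      _ ≤ 1 * ‖y‖ := by gcongr; exact h.norm_green_le hz k
      _ = ‖y‖ := one_mul _
  set z := Complex.I
  set A : ℤ → ℂ := fun k => pair (toL2 (tail k (φ z))) y with hA
  set B : ℤ → ℂ := fun k => pair (toL2 (tail k (θ z))) y with hB
  have hg : ∀ k, φ z k * pair (weyl φ θ m z) y + (θ z k * A (k + 1) - φ z k * B (k + 1)) = 0 :=
    fun k => by
      rw [← hres k, green]; simp [hA, hB]
  have hAs : ∀ k, A k = A (k + 1) + φ z k * y k := fun k => pair_tail_sub (h.tail_φ z) k y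
  have hBs : ∀ k, B k = B (k + 1) + θ z k * y k := fun k => pair_tail_sub (h.tail_θ z) k y
  have hAB : ∀ k, A k = 0 ∧ B k = pair (weyl φ θ m z) y := fun k => by
    have g1 := hg k
    have g2 := hg (k - 1)
    rw [sub_add_cancel] at g2
    have w := h.wr_eq_one z k
    rw [wr] at w
    have a := hAs k
    have b := hBs k
    constructor
    · linear_combination (-A k) * w + p k * φ z k * g2 - p k * φ z (k - 1) * g1
        - p k * φ z (k - 1) * θ z k * a + p k * φ z (k - 1) * φ z k * b
    · linear_combination (-(B k - pair (weyl φ θ m z) y)) * w + p k * θ z k * g2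
        - p k * θ z (k - 1) * g1
        - p k * θ z (k - 1) * θ z k * a + p k * θ z (k - 1) * φ z k * b
  ext k
  have a := hAs k
  have b := hBs k
  rw [(hAB k).1, (hAB (k + 1)).1] at a
  rw [(hAB k).2, (hAB (k + 1)).2] at b
  have w := h.wr_eq_one z k
  rw [wr] at w
  change y k = 0
  linear_combination (-y k) * w - p k * θ z (k - 1) * a + p k * φ z (k - 1) * b

/-! ### The eigenfunction expansion -/

lemma inner_eigenvec (h : MeromorphicWeyl p d φ θ m lam) (n : ℕ) (y : SeqL2) :
    inner ℂ (eigenvec φ lam n) y = pair (eigenvec φ lam n) y := by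
  rw [pair_eq_inner]
  congr 1
  ext k
  exact (h.eigenvec_conj n k).symm

/-- Every vector of `ℓ²(ℤ)` is the sum of its eigenfunction expansion. -/
lemma hasSum_eigenvec (h : MeromorphicWeyl p d φ θ m lam) (y : SeqL2) :
    HasSum (fun n => (((‖eigenvec φ lam n‖ ^ 2 : ℝ) : ℂ)⁻¹ * pair (eigenvec φ lam n) y) •
      eigenvec φ lam n) y := by
  set e : ℕ → SeqL2 := fun n => ((‖eigenvec φ lam n‖ : ℂ)⁻¹) • eigenvec φ lam n with he
  have hne : ∀ n, (‖eigenvec φ lam n‖ : ℂ) ≠ 0 := fun n => by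
    simpa using h.eigenvec_ne_zero n
  have hon : Orthonormal ℂ e := by
    refine ⟨fun n => ?_, fun n k hnk => ?_⟩
    · rw [he]
      simp only [norm_smul, norm_inv, Complex.norm_real, norm_norm]
      exact inv_mul_cancel₀ (by simpa using h.eigenvec_ne_zero n)
    · simp only [he]
      rw [inner_smul_left, inner_smul_right, h.inner_eigenvec, h.pair_eigenvec_of_ne hnk]
      simp
  have hperp : (Submodule.span ℂ (Set.range e))ᗮ = ⊥ := by
    rw [Submodule.eq_bot_iff]
    intro x hx
    refine h.eq_zero_of_pair_eigenvec fun n => ?_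
    have := (Submodule.mem_orthogonal _ x).1 hx (e n) (Submodule.subset_span ⟨n, rfl⟩)
    rw [he] at this
    simp only at this
    rw [inner_smul_left, h.inner_eigenvec] at this
    refine (mul_eq_zero.1 this).resolve_left ?_
    simpa using h.eigenvec_ne_zero n
  have hs := (HilbertBasis.mkOfOrthogonalEqBot hon hperp).hasSum_repr y
  refine hs.congr_fun fun n => ?_
  rw [HilbertBasis.repr_apply_apply, HilbertBasis.coe_mkOfOrthogonalEqBot]
  simp only [he]
  rw [inner_smul_left, h.inner_eigenvec, smul_smul]
  congr 1
  have := hne n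
  simp only [map_inv₀, Complex.conj_ofReal]
  push_cast
  field_simp

lemma pair_green_eigenvec (h : MeromorphicWeyl p d φ θ m lam) {z : ℂ} (hz : z ∈ regularSet lam)
    (k : ℤ) (n : ℕ) :
    (lam n - z) * pair (green φ θ m k z) (eigenvec φ lam n) = -φ (lam n) k := by
  have e1 := h.pair_eigenvec_weyl n hz
  rw [pair_comm] at e1
  have e2 := green_tail (k := k + 1) (h.eigen_φ z) (h.eigen_φ (lam n)) (h.tail_φ z)
    (y := eigenvec φ lam n) (fun j _ => h.eigenvec_apply n j) (h.wr_φφ _ _)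
  have e3 := green_tail (k := k + 1) (h.eigen_θ z) (h.eigen_φ (lam n)) (h.tail_θ z)
    (y := eigenvec φ lam n) (fun j _ => h.eigenvec_apply n j) (h.wr_θφ _ _)
  have e4 := h.wr_eq_one z (k + 1)
  simp only [wr, add_sub_cancel_right] at e2 e3 e4
  simp only [green, map_add, map_sub, map_smul, add_apply, sub_apply, smul_apply, smul_eq_mul]
  linear_combination φ z k * e1 - θ z k * e2 + φ z k * e3 - φ (lam n) k * e4

/-- Uniform control of the eigenfunction expansion by Green's function: a vector `F` for which
multiplication of its coefficients by the eigenvalues gives the coefficients of another vector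
of `ℓ²(ℤ)` is approximated by the partial sums at each index `k` up to the norm of Green's function
at `k` times a null sequence. -/
lemma expansion_bound (h : MeromorphicWeyl p d φ θ m lam) {F F' : SeqL2}
    (hFF' : ∀ n, pair (eigenvec φ lam n) F' = lam n * pair (eigenvec φ lam n) F)
    {z : ℂ} (hz : z ∈ regularSet lam) :
    ∃ ε : ℕ → ℝ, (∀ N, 0 ≤ ε N) ∧ Tendsto ε atTop (𝓝 0) ∧ ∀ (N : ℕ) (k : ℤ),
      ‖F k - ∑ n ∈ Finset.range N, (((‖eigenvec φ lam n‖ ^ 2 : ℝ) : ℂ)⁻¹ *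
        pair (eigenvec φ lam n) F) * φ (lam n) k‖ ≤ ‖green φ θ m k z‖ * ε N := by
  set G := F' - z • F with hG
  set b : ℕ → ℂ := fun n => ((‖eigenvec φ lam n‖ ^ 2 : ℝ) : ℂ)⁻¹ * pair (eigenvec φ lam n) G with hb
  set c : ℕ → ℂ := fun n => ((‖eigenvec φ lam n‖ ^ 2 : ℝ) : ℂ)⁻¹ * pair (eigenvec φ lam n) F with hc
  have hbc : ∀ n, b n = (lam n - z) * c n := fun n => by
    simp only [hb, hc, hG, map_sub, map_smul, hFF', smul_eq_mul]; ring
  have hsG := h.hasSum_eigenvec G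
  have hsF := h.hasSum_eigenvec F
  refine ⟨fun N => ‖G - ∑ n ∈ Finset.range N, b n • eigenvec φ lam n‖,
    fun N => norm_nonneg _, ?_, fun N k => ?_⟩
  · have := (hsG.tendsto_sum_nat.const_sub G).norm
    rw [sub_self, norm_zero] at this
    exact this
  · have hterm : ∀ n, pair (green φ θ m k z) (b n • eigenvec φ lam n) = -(c n * φ (lam n) k) := by
      intro n
      have := h.pair_green_eigenvec hz k n
      rw [map_smul, smul_eq_mul, hbc]
      linear_combination c n * this
    have hF : F k = -pair (green φ θ m k z) G := by
      have s1 := hsG.mapL (pair (green φ θ m k z))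
      have s2 := hsF.mapL (lp.evalCLM ℂ (fun _ : ℤ => ℂ) 2 k)
      refine s2.unique ?_
      refine s1.neg.congr_fun fun n => ?_
      have := hterm n
      simp only [hb, hc] at this
      rw [this, neg_neg, ← h.eigenvec_apply n k]
      rfl
    have hkey : F k - ∑ n ∈ Finset.range N, c n * φ (lam n) k
        = -pair (green φ θ m k z) (G - ∑ n ∈ Finset.range N, b n • eigenvec φ lam n) := by
      rw [hF, map_sub _ G, map_sum, Finset.sum_congr rfl fun n _ => hterm n,
        Finset.sum_neg_distrib]
      ring
    rw [hkey, norm_neg]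
    exact norm_pair_le _ _

lemma hasSum_apply (h : MeromorphicWeyl p d φ θ m lam) (F : SeqL2) (k : ℤ) :
    HasSum (fun n => (((‖eigenvec φ lam n‖ ^ 2 : ℝ) : ℂ)⁻¹ * pair (eigenvec φ lam n) F) *
      φ (lam n) k) (F k) := by
  have s := (h.hasSum_eigenvec F).mapL (lp.evalCLM ℂ (fun _ : ℤ => ℂ) 2 k)
  refine s.congr_fun fun n => ?_
  rw [← h.eigenvec_apply n k]
  rfl

/-- For a function in the domain, the coefficients of its image under the operator arise by
multiplication with the eigenvalues. The boundary condition at `-∞` is given only for the Weyl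
solutions off the real axis; it is transported to the eigenfunction by approaching the pole
vertically. -/
lemma pair_eigenvec_jacobi (h : MeromorphicWeyl p d φ θ m lam) {f : ℤ → ℂ} (hf : Memℓp f 2)
    (hJf : Memℓp (jacobi p d f) 2) (hφf : ∀ z, Tendsto (wr p (φ z) f) atTop (𝓝 0)) {κ : ℂ}
    (hθf : ∀ z, Tendsto (wr p (θ z) f) atTop (𝓝 κ))
    (hψf : ∀ z : ℂ, z.im ≠ 0 →
      Tendsto (fun k : ℕ => wr p (sol φ θ z (m z)) f (-(k : ℤ))) atTop (𝓝 0)) (n : ℕ) :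
    pair (eigenvec φ lam n) (toL2 (jacobi p d f))
      = lam n * pair (eigenvec φ lam n) (toL2 f) := by
  have hz : ∀ z : ℂ, z.im ≠ 0 →
      z * pair (weyl φ θ m z) (toL2 f) - pair (weyl φ θ m z) (toL2 (jacobi p d f)) = -κ := by
    intro z hz
    have hm := h.mem_sol z hz
    have hω : Tendsto (wr p (sol φ θ z (m z)) f) atTop (𝓝 κ) := by
      have := (hθf z).add ((hφf z).const_mul (m z))
      rw [mul_zero, add_zero] at this
      refine this.congr fun k => ?_
      simp only [wr, sol]; ring
    have := green_full (p := p) (d := d) (x := weyl φ θ m z) (y := toL2 f)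
      (x' := z • weyl φ θ m z) (y' := toL2 (jacobi p d f)) (ω := κ) (ω' := 0)
      (fun k => by
        have h1 := h.eigen_sol z (m z) k
        change z * weyl φ θ m z k = _
        rw [weyl, toL2_coe hm, h1])
      (fun k => by rw [toL2_coe hJf, toL2_coe hf])
      (by rw [weyl, toL2_coe hm, toL2_coe hf]; exact hω)
      (by rw [weyl, toL2_coe hm, toL2_coe hf]; exact hψf z hz)
    simpa using this
  have hvert : Tendsto (fun t : ℝ => (lam n : ℂ) + t * Complex.I) (𝓝[>] 0)
      (𝓝[≠] (lam n : ℂ)) := by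
    refine tendsto_nhdsWithin_iff.2 ⟨?_, ?_⟩
    · have : Continuous fun t : ℝ => (lam n : ℂ) + t * Complex.I := by fun_prop
      simpa using (this.tendsto 0).mono_left nhdsWithin_le_nhds
    · filter_upwards [self_mem_nhdsWithin] with t ht
      simpa using (ne_of_gt ht)
  have hlim : Tendsto (fun z : ℂ => z * ((m z)⁻¹ * pair (weyl φ θ m z) (toL2 f))
      - (m z)⁻¹ * pair (weyl φ θ m z) (toL2 (jacobi p d f)) + (m z)⁻¹ * κ) (𝓝[≠] (lam n : ℂ))
      (𝓝 (lam n * pair (eigenvec φ lam n) (toL2 f)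
        - pair (eigenvec φ lam n) (toL2 (jacobi p d f)) + 0 * κ)) :=
    (((tendsto_id.mono_left nhdsWithin_le_nhds).mul (h.tendsto_pair_eigenvec n _)).sub
      (h.tendsto_pair_eigenvec n _)).add ((h.tendsto_inv n).mul_const κ)
  have h0 : Tendsto (fun _ : ℝ => (0 : ℂ)) (𝓝[>] (0 : ℝ)) (𝓝 0) := tendsto_const_nhds
  have := tendsto_nhds_unique (hlim.comp hvert) (h0.congr' (by
    filter_upwards [self_mem_nhdsWithin] with t ht
    have := hz (lam n + t * Complex.I) (by simpa using (ne_of_gt ht))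
    simp only [Function.comp_apply]
    linear_combination -(m (lam n + t * Complex.I))⁻¹ * this))
  linear_combination -this

end MeromorphicWeyl

/-! ### From functions on the lattice to sequences -/

section Lattice

variable {q : ℝ}

/-- The values of a function on the lattice, multiplied by the square roots of the weights of
Jackson's integral: this turns `L²(ℝ_q^+)` into `ℓ²(ℤ)`. The origin corresponds to `+∞`. -/
def scale (q : ℝ) (f : ℝ → ℂ) (n : ℤ) : ℂ := (Real.sqrt ((1 - q) * q ^ n) : ℂ) * f (q ^ n)

/-- The off-diagonal coefficients of the `q`-Schrödinger operator in the sequence picture. -/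
def offDiag (q : ℝ) (n : ℤ) : ℝ :=
  (1 - q) * (q ^ n)⁻¹ / (Real.sqrt ((1 - q) * q ^ n) * Real.sqrt ((1 - q) * q ^ (n - 1)))

/-- The diagonal coefficients of the `q`-Schrödinger operator in the sequence picture. -/
def diag (q : ℝ) (V : ℝ → ℝ) (n : ℤ) : ℝ := V (q ^ n) + (1 + q) / q * (q ^ n)⁻¹ ^ 2

lemma weight_pos (hq0 : 0 < q) (hq1 : q < 1) (n : ℤ) : 0 < (1 - q) * q ^ n :=
  mul_pos (sub_pos.2 hq1) (zpow_pos hq0 n)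

lemma sqrt_weight_ne_zero (hq0 : 0 < q) (hq1 : q < 1) (n : ℤ) :
    (Real.sqrt ((1 - q) * q ^ n) : ℂ) ≠ 0 := by
  exact_mod_cast (Real.sqrt_pos.2 (weight_pos hq0 hq1 n)).ne'

lemma sqrt_weight_sq (hq0 : 0 < q) (hq1 : q < 1) (n : ℤ) :
    (Real.sqrt ((1 - q) * q ^ n) : ℂ) ^ 2 = (1 - q) * (q : ℂ) ^ n := by
  rw [← Complex.ofReal_pow, Real.sq_sqrt (weight_pos hq0 hq1 n).le]
  push_cast; rfl

lemma inv_mul_zpow (hq0 : 0 < q) (n : ℤ) : q⁻¹ * q ^ n = q ^ (n - 1) := by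
  rw [zpow_sub_one₀ hq0.ne', mul_comm]

lemma mul_zpow_self (hq0 : 0 < q) (n : ℤ) : q * q ^ n = q ^ (n + 1) := by
  rw [zpow_add_one₀ hq0.ne', mul_comm]

lemma norm_scale_sq (hq0 : 0 < q) (hq1 : q < 1) (f : ℝ → ℂ) (n : ℤ) :
    ‖scale q f n‖ ^ 2 = (1 - q) * (q ^ n * ‖f (q ^ n)‖ ^ 2) := by
  rw [scale, norm_mul, Complex.norm_real, Real.norm_of_nonneg (Real.sqrt_nonneg _), mul_pow,
    Real.sq_sqrt (weight_pos hq0 hq1 n).le]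
  ring

lemma memℓp_scale (hq0 : 0 < q) (hq1 : q < 1) {f : ℝ → ℂ} (hf : MemL2 q f) :
    Memℓp (scale q f) 2 := by
  rw [memℓp_two_iff]
  simp only [norm_scale_sq hq0 hq1]
  exact hf.mul_left _

lemma wr_scale (hq0 : 0 < q) (hq1 : q < 1) (f g : ℝ → ℂ) (n : ℤ) :
    wr (offDiag q) (scale q f) (scale q g) n
      = (1 - q) * ((q : ℂ) ^ n)⁻¹ * (f (q ^ n) * g (q ^ (n - 1)) - g (q ^ n) * f (q ^ (n - 1))) := by
  have h1 := sqrt_weight_ne_zero hq0 hq1 n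
  have h2 := sqrt_weight_ne_zero hq0 hq1 (n - 1)
  simp only [wr, offDiag, scale]
  push_cast
  field_simp

lemma wr_scale_eq_wronskian (hq0 : 0 < q) (hq1 : q < 1) (f g : ℝ → ℂ) (n : ℤ) :
    wr (offDiag q) (scale q f) (scale q g) n = wronskian q f g (q ^ n) := by
  have h0 : (q : ℂ) ≠ 0 := by exact_mod_cast hq0.ne'
  have h1 : (1 : ℂ) - q ≠ 0 := by exact_mod_cast (sub_pos.2 hq1).ne'
  have h2 : (q : ℂ) ^ n ≠ 0 := zpow_ne_zero n h0
  rw [wr_scale hq0 hq1]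
  simp only [wronskian, qDerivBack, qDeriv, inv_mul_zpow hq0, mul_zpow_self hq0,
    sub_add_cancel]
  push_cast
  rw [zpow_sub_one₀ h0]
  field_simp
  ring

lemma jacobi_scale (hq0 : 0 < q) (hq1 : q < 1) (V : ℝ → ℝ) (f : ℝ → ℂ) :
    jacobi (offDiag q) (diag q V) (scale q f) = scale q (qSchrodinger q V f) := by
  funext n
  have h0 : (q : ℂ) ≠ 0 := by exact_mod_cast hq0.ne'
  have h1 : (1 : ℂ) - q ≠ 0 := by exact_mod_cast (sub_pos.2 hq1).ne'
  have h2 : (q : ℂ) ^ n ≠ 0 := zpow_ne_zero n h0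
  have a1 := sqrt_weight_ne_zero hq0 hq1 n
  have a2 := sqrt_weight_ne_zero hq0 hq1 (n - 1)
  have a3 := sqrt_weight_ne_zero hq0 hq1 (n + 1)
  have e := sqrt_weight_sq hq0 hq1 n
  simp only [jacobi, scale, offDiag, diag, qSchrodinger, qLaplace, inv_mul_zpow hq0,
    mul_zpow_self hq0, add_sub_cancel_right]
  push_cast
  rw [zpow_add_one₀ h0]
  generalize (Real.sqrt ((1 - q) * q ^ n) : ℂ) = s at *
  generalize (Real.sqrt ((1 - q) * q ^ (n - 1)) : ℂ) = s' at *
  generalize (Real.sqrt ((1 - q) * q ^ (n + 1)) : ℂ) = s'' at *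
  generalize f (q ^ (n - 1)) = f'
  generalize f (q ^ (n + 1)) = f''
  generalize f (q ^ n) = f₀
  generalize (q : ℂ) ^ n = x at *
  field_simp
  linear_combination (q * f' + f'') * e

lemma isEigen_scale (hq0 : 0 < q) (hq1 : q < 1) {V : ℝ → ℝ} {z : ℂ} {f : ℝ → ℂ}
    (hf : IsSolution q V z f) : IsEigen (offDiag q) (diag q V) z (scale q f) := fun n => by
  rw [jacobi_scale hq0 hq1]
  have := hf (q ^ n) ⟨n, rfl⟩
  simp only [scale, qSchrodinger]
  linear_combination -(Real.sqrt ((1 - q) * q ^ n) : ℂ) * this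

lemma tendsto_int_of_nat_succ {u : ℤ → ℂ} {a : ℂ}
    (h : Tendsto (fun k : ℕ => u ((k : ℤ) + 1)) atTop (𝓝 a)) : Tendsto u atTop (𝓝 a) := by
  have ht : Tendsto (fun n : ℤ => (n - 1).toNat) atTop atTop := by
    refine tendsto_atTop.2 fun b => ?_
    filter_upwards [eventually_ge_atTop ((b : ℤ) + 1)] with n hn
    omega
  refine (h.comp ht).congr' ?_
  filter_upwards [eventually_ge_atTop (1 : ℤ)] with n hn
  simp only [Function.comp_apply]
  congr 1
  omega

/-- The Wronskian of two functions with values at the origin has a limit there. -/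
lemma tendsto_wr_scale (hq0 : 0 < q) (hq1 : q < 1) {f g : ℝ → ℂ} {a b a' b' : ℂ}
    (hf : HasValuesAtZero q f a b) (hg : HasValuesAtZero q g a' b') :
    Tendsto (wr (offDiag q) (scale q f) (scale q g)) atTop
      (𝓝 ((1 - (q : ℂ)) ^ 2 / q * (a * b' - a' * b))) := by
  have h0 : (q : ℂ) ≠ 0 := by exact_mod_cast hq0.ne'
  have hqk : Tendsto (fun k : ℕ => (q : ℂ) ^ k) atTop (𝓝 0) :=
    tendsto_pow_atTop_nhds_zero_of_norm_lt_one (by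
      rw [Complex.norm_real, Real.norm_of_nonneg hq0.le]; exact hq1)
  set β : ℕ → ℂ := fun k => (f (q ^ k) - a) / (q : ℂ) ^ k with hβ
  set γ : ℕ → ℂ := fun k => (g (q ^ k) - a') / (q : ℂ) ^ k with hγ
  have hb : Tendsto β atTop (𝓝 b) := hf.2
  have hc : Tendsto γ atTop (𝓝 b') := hg.2
  have hb1 := hb.comp (tendsto_add_atTop_nat 1)
  have hc1 := hc.comp (tendsto_add_atTop_nat 1)
  have hfk : ∀ k, f (q ^ k) = a + (q : ℂ) ^ k * β k := fun k => by
    have : (q : ℂ) ^ k ≠ 0 := pow_ne_zero k h0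
    simp only [hβ]; field_simp; ring
  have hgk : ∀ k, g (q ^ k) = a' + (q : ℂ) ^ k * γ k := fun k => by
    have : (q : ℂ) ^ k ≠ 0 := pow_ne_zero k h0
    simp only [hγ]; field_simp; ring
  refine tendsto_int_of_nat_succ ?_
  have hlim : Tendsto (fun k : ℕ => (1 - (q : ℂ)) * ((a * γ k - a' * β k) / q
      + (a' * β (k + 1) - a * γ (k + 1))
      + (q : ℂ) ^ k * (β (k + 1) * γ k - γ (k + 1) * β k))) atTop
      (𝓝 ((1 - (q : ℂ)) * ((a * b' - a' * b) / q + (a' * b - a * b')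
        + 0 * (b * b' - b' * b)))) := by
    exact ((((hc.const_mul a).sub (hb.const_mul a')).div_const _).add
      ((hb1.const_mul a').sub (hc1.const_mul a))).add
      (hqk.mul ((hb1.mul hc).sub (hc1.mul hb))) |>.const_mul _
  have e : (1 - (q : ℂ)) ^ 2 / q * (a * b' - a' * b) = (1 - (q : ℂ)) * ((a * b' - a' * b) / q
      + (a' * b - a * b') + 0 * (b * b' - b' * b)) := by
    field_simp; ring
  rw [e]
  refine hlim.congr fun k => ?_
  rw [wr_scale hq0 hq1, add_sub_cancel_right]
  have e1 : q ^ ((k : ℤ) + 1) = q ^ (k + 1) := by exact_mod_cast zpow_natCast q (k + 1)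
  have e2 : (q : ℂ) ^ ((k : ℤ) + 1) = (q : ℂ) ^ (k + 1) := by
    exact_mod_cast zpow_natCast (q : ℂ) (k + 1)
  rw [e1, e2, zpow_natCast, hfk, hfk, hgk, hgk]
  have : (q : ℂ) ^ k ≠ 0 := pow_ne_zero k h0
  rw [pow_succ]
  field_simp
  ring

lemma tailL2_scale (hq0 : 0 < q) (hq1 : q < 1) {f : ℝ → ℂ} {a b : ℂ}
    (hf : HasValuesAtZero q f a b) : TailL2 (scale q f) := by
  refine tailL2_of_nat ?_
  obtain ⟨C, hC⟩ := (hf.1.norm.pow 2).bddAbove_range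
  refine ((summable_geometric_of_lt_one hq0.le hq1).mul_left ((1 - q) * C)).of_nonneg_of_le
    (fun _ => by positivity) fun i => ?_
  rw [norm_scale_sq hq0 hq1, zpow_natCast]
  have h1 : ‖f (q ^ i)‖ ^ 2 ≤ C := hC ⟨i, rfl⟩
  have h2 : 0 < 1 - q := sub_pos.2 hq1
  have h3 : 0 < q ^ i := pow_pos hq0 i
  calc (1 - q) * (q ^ i * ‖f (q ^ i)‖ ^ 2) ≤ (1 - q) * (q ^ i * C) := by gcongr
    _ = _ := by ring

lemma conj_scale (f : ℝ → ℂ) (n : ℤ) :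
    conj (scale q f n) = scale q (fun x => conj (f x)) n := by
  simp [scale]

lemma HasValuesAtZero.conj {f : ℝ → ℂ} {a b : ℝ}
    (hf : HasValuesAtZero q f a b) : HasValuesAtZero q (fun x => conj (f x)) a b := by
  constructor
  · simpa [Function.comp_def] using (Complex.continuous_conj.tendsto _).comp hf.1
  · simpa [Function.comp_def] using (Complex.continuous_conj.tendsto _).comp hf.2

end Lattice

/-! ### The `q`-Sturm-Liouville problem as a regular frame -/

section Frame

variable {q : ℝ} {V : ℝ → ℝ}

/-- The common factor `√q / (1 - q)` of the initial values of `φ` and `θ` makes their Wronskian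
equal to `1`. -/
lemma normalization (hq0 : 0 < q) (hq1 : q < 1) :
    (1 - (q : ℂ)) ^ 2 / q * ((Real.sqrt q / (1 - q) : ℝ) : ℂ) ^ 2 = 1 := by
  have h0 : q ≠ 0 := hq0.ne'
  have h1 : 1 - q ≠ 0 := (sub_pos.2 hq1).ne'
  have : (1 - q) ^ 2 / q * (Real.sqrt q / (1 - q)) ^ 2 = 1 := by
    rw [div_pow, Real.sq_sqrt hq0.le]; field_simp
  exact_mod_cast this

lemma IsSolution.conj {z : ℂ} {f : ℝ → ℂ} (hf : IsSolution q V z f) :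
    IsSolution q V (conj z) (fun x => conj (f x)) := fun x hx => by
  have := congrArg (starRingEnd ℂ) (hf x hx)
  simpa [qLaplace] using this

/-- A solution is determined by its Wronskians at the origin. -/
lemma eq_of_wr {p d : ℤ → ℝ} {z : ℂ} {F G u v : ℤ → ℂ} (hF : IsEigen p d z F)
    (hG : IsEigen p d z G) (hu : IsEigen p d z u) (hv : IsEigen p d z v) {a b : ℂ}
    (hFG : Tendsto (wr p F G) atTop (𝓝 1)) (huF : Tendsto (wr p u F) atTop (𝓝 a))
    (hvF : Tendsto (wr p v F) atTop (𝓝 a)) (huG : Tendsto (wr p u G) atTop (𝓝 b))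
    (hvG : Tendsto (wr p v G) atTop (𝓝 b)) (n : ℤ) : u n = v n := by
  have e1 := mul_wr p u F G n
  have e2 := mul_wr p v F G n
  rw [wr_const hF hG hFG, wr_const hu hG huG, wr_const hu hF huF] at e1
  rw [wr_const hF hG hFG, wr_const hv hG hvG, wr_const hv hF hvF] at e2
  linear_combination e1 - e2

lemma regularFrame_of_solutions (hq0 : 0 < q) (hq1 : q < 1) {α : ℝ} {φ θ : ℝ → ℂ → ℂ}
    (hφ : ∀ z : ℂ, IsSolution q V z (fun x => φ x z))
    (hφ0 : ∀ z : ℂ, HasValuesAtZero q (fun x => φ x z)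
      ((Real.sqrt q / (1 - q) * Real.sin α : ℝ) : ℂ)
      ((-(Real.sqrt q / (1 - q) * Real.cos α) : ℝ) : ℂ))
    (hθ : ∀ z : ℂ, IsSolution q V z (fun x => θ x z))
    (hθ0 : ∀ z : ℂ, HasValuesAtZero q (fun x => θ x z)
      ((Real.sqrt q / (1 - q) * Real.cos α : ℝ) : ℂ)
      ((Real.sqrt q / (1 - q) * Real.sin α : ℝ) : ℂ)) :
    RegularFrame (offDiag q) (diag q V) (fun z => scale q fun x => φ x z)
      (fun z => scale q fun x => θ x z) := by
  have hnorm := normalization hq0 hq1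
  have hcs : ((Real.sin α : ℝ) : ℂ) ^ 2 + ((Real.cos α : ℝ) : ℂ) ^ 2 = 1 := by
    exact_mod_cast Real.sin_sq_add_cos_sq α
  -- the Wronskians at the origin, for any functions with the given values
  have wφφ : ∀ {f g : ℝ → ℂ}, HasValuesAtZero q f ((Real.sqrt q / (1 - q) * Real.sin α : ℝ) : ℂ)
      ((-(Real.sqrt q / (1 - q) * Real.cos α) : ℝ) : ℂ) →
      HasValuesAtZero q g ((Real.sqrt q / (1 - q) * Real.sin α : ℝ) : ℂ)
      ((-(Real.sqrt q / (1 - q) * Real.cos α) : ℝ) : ℂ) →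
      Tendsto (wr (offDiag q) (scale q f) (scale q g)) atTop (𝓝 0) := fun hf hg => by
    convert tendsto_wr_scale hq0 hq1 hf hg using 2
    ring
  have wθθ : ∀ {f g : ℝ → ℂ}, HasValuesAtZero q f ((Real.sqrt q / (1 - q) * Real.cos α : ℝ) : ℂ)
      ((Real.sqrt q / (1 - q) * Real.sin α : ℝ) : ℂ) →
      HasValuesAtZero q g ((Real.sqrt q / (1 - q) * Real.cos α : ℝ) : ℂ)
      ((Real.sqrt q / (1 - q) * Real.sin α : ℝ) : ℂ) →
      Tendsto (wr (offDiag q) (scale q f) (scale q g)) atTop (𝓝 0) := fun hf hg => by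
    convert tendsto_wr_scale hq0 hq1 hf hg using 2
    ring
  have wφθ : ∀ {f g : ℝ → ℂ}, HasValuesAtZero q f ((Real.sqrt q / (1 - q) * Real.sin α : ℝ) : ℂ)
      ((-(Real.sqrt q / (1 - q) * Real.cos α) : ℝ) : ℂ) →
      HasValuesAtZero q g ((Real.sqrt q / (1 - q) * Real.cos α : ℝ) : ℂ)
      ((Real.sqrt q / (1 - q) * Real.sin α : ℝ) : ℂ) →
      Tendsto (wr (offDiag q) (scale q f) (scale q g)) atTop (𝓝 1) := fun hf hg => by
    convert tendsto_wr_scale hq0 hq1 hf hg using 2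
    simp only [Complex.ofReal_mul, Complex.ofReal_neg]
    linear_combination -hnorm - (1 - (q : ℂ)) ^ 2 / q * ((Real.sqrt q / (1 - q) : ℝ) : ℂ) ^ 2 * hcs
  have wθφ : ∀ {f g : ℝ → ℂ}, HasValuesAtZero q f ((Real.sqrt q / (1 - q) * Real.cos α : ℝ) : ℂ)
      ((Real.sqrt q / (1 - q) * Real.sin α : ℝ) : ℂ) →
      HasValuesAtZero q g ((Real.sqrt q / (1 - q) * Real.sin α : ℝ) : ℂ)
      ((-(Real.sqrt q / (1 - q) * Real.cos α) : ℝ) : ℂ) →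
      Tendsto (wr (offDiag q) (scale q f) (scale q g)) atTop (𝓝 (-1)) := fun hf hg => by
    refine (wφθ hg hf).neg.congr fun n => ?_
    exact (wr_swap _ _ _ n).symm
  have eφ : ∀ z, IsEigen (offDiag q) (diag q V) z (scale q fun x => φ x z) := fun z =>
    isEigen_scale hq0 hq1 (hφ z)
  have eθ : ∀ z, IsEigen (offDiag q) (diag q V) z (scale q fun x => θ x z) := fun z =>
    isEigen_scale hq0 hq1 (hθ z)
  refine ⟨eφ, eθ, fun z n => ?_, fun z n => ?_, fun z => tailL2_scale hq0 hq1 (hφ0 z),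
    fun z => tailL2_scale hq0 hq1 (hθ0 z), fun z z' => wφφ (hφ0 z) (hφ0 z'),
    fun z z' => wφθ (hφ0 z) (hθ0 z'), fun z z' => wθθ (hθ0 z) (hθ0 z')⟩
  · rw [conj_scale]
    have hc := (hφ0 z).conj
    exact eq_of_wr (eφ (conj z)) (eθ (conj z)) (isEigen_scale hq0 hq1 (hφ z).conj) (eφ (conj z))
      (wφθ (hφ0 _) (hθ0 _)) (wφφ hc (hφ0 _)) (wφφ (hφ0 _) (hφ0 _)) (wφθ hc (hθ0 _))
      (wφθ (hφ0 _) (hθ0 _)) n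
  · rw [conj_scale]
    have hc := (hθ0 z).conj
    exact eq_of_wr (eφ (conj z)) (eθ (conj z)) (isEigen_scale hq0 hq1 (hθ z).conj) (eθ (conj z))
      (wφθ (hφ0 _) (hθ0 _)) (wθφ hc (hφ0 _)) (wθφ (hθ0 _) (hφ0 _)) (wθθ hc (hθ0 _))
      (wθθ (hθ0 _) (hθ0 _)) n

lemma sol_scale (φ θ : ℝ → ℂ → ℂ) (z l : ℂ) :
    sol (fun z => scale q fun x => φ x z) (fun z => scale q fun x => θ x z) z l
      = scale q fun x => θ x z + l * φ x z := by
  funext n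
  simp only [sol, scale]; ring

/-- On the Weyl circle, `u = θ + l φ` satisfies a real boundary condition, so that its Wronskian with
its conjugate vanishes. -/
lemma wronskian_conj_of_mem_weylCircle {θ φ : ℝ → ℂ} {b : ℝ} {l : ℂ}
    (hl : l ∈ weylCircle q θ φ b) :
    wronskian q (fun x => θ x + l * φ x) (fun x => conj (θ x + l * φ x)) b = 0 := by
  obtain ⟨β, hβ⟩ := hl
  set u : ℝ → ℂ := fun x => θ x + l * φ x with hu
  have hD : qDerivBack q u b = qDerivBack q θ b + l * qDerivBack q φ b := by
    simp only [qDerivBack, qDeriv, hu]; ring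
  have hDc : qDerivBack q (fun x => conj (u x)) b = conj (qDerivBack q u b) := by
    simp [qDerivBack, qDeriv]
  have e1 : u b * (Real.cos β : ℂ) + qDerivBack q u b * (Real.sin β : ℂ) = 0 := by
    rw [hD]; exact hβ
  have e2 := congrArg (starRingEnd ℂ) e1
  rw [map_add, map_mul, map_mul, Complex.conj_ofReal, Complex.conj_ofReal, map_zero] at e2
  have hcs : ((Real.sin β : ℝ) : ℂ) ^ 2 + ((Real.cos β : ℝ) : ℂ) ^ 2 = 1 := by
    exact_mod_cast Real.sin_sq_add_cos_sq β
  have e3 : u b * conj (qDerivBack q u b) - conj (u b) * qDerivBack q u b = 0 := by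
    linear_combination (-(u b * conj (qDerivBack q u b) - conj (u b) * qDerivBack q u b)) * hcs
      + ((Real.cos β : ℂ) * conj (qDerivBack q u b) - (Real.sin β : ℂ) * conj (u b)) * e1
      + ((Real.sin β : ℂ) * u b - (Real.cos β : ℂ) * qDerivBack q u b) * e2
  change (1 - (q : ℂ)) ^ 2 / q * (u b * qDerivBack q (fun x => conj (u x)) b
    - conj (u b) * qDerivBack q u b) = 0
  rw [hDc, e3, mul_zero]

lemma meromorphicWeyl_of_solutions (hq0 : 0 < q) (hq1 : q < 1) {φ θ : ℝ → ℂ → ℂ}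
    (hF : RegularFrame (offDiag q) (diag q V) (fun z => scale q fun x => φ x z)
      (fun z => scale q fun x => θ x z)) {m : ℂ → ℂ}
    (hm : ∀ z : ℂ, z.im ≠ 0 → m z ∈ weylLimit q (fun x => θ x z) (fun x => φ x z))
    {lam : ℕ → ℝ} (hlam : Function.Injective lam)
    (hanalytic : ∀ z : ℂ, (∀ n, z ≠ (lam n : ℂ)) → AnalyticAt ℂ m z)
    (hpole : ∀ n, meromorphicOrderAt m (lam n : ℂ) < 0) :
    MeromorphicWeyl (offDiag q) (diag q V) (fun z => scale q fun x => φ x z)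
      (fun z => scale q fun x => θ x z) m lam := by
  set Φ : ℂ → ℤ → ℂ := fun z => scale q fun x => φ x z
  set Θ : ℂ → ℤ → ℂ := fun z => scale q fun x => θ x z
  have key : ∀ z : ℂ, z.im ≠ 0 → Memℓp (sol Φ Θ z (m z)) 2 ∧
      z.im * ‖toL2 (sol Φ Θ z (m z))‖ ^ 2 = -(m z).im := fun z hz => by
    obtain ⟨l, hl, hlm⟩ := hm z hz
    refine hF.weyl_solution hz (l := l) (fun k => ?_) hlm
    have := wronskian_conj_of_mem_weylCircle (hl k)
    rw [← wr_scale_eq_wronskian hq0 hq1] at this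
    rw [sol_scale]
    simpa only [conj_scale] using this
  exact { hF with
    mem_sol := fun z hz => (key z hz).1
    norm_sol := fun z hz => (key z hz).2
    injective := hlam
    analytic := hanalytic
    pole := hpole }

end Frame

end QSturm

end

open QSturm in
theorem theorem3 (q : ℝ) (hq0 : 0 < q) (hq1 : q < 1) (V : ℝ → ℝ) (α : ℝ)
    (φ θ : ℝ → ℂ → ℂ)
    (hφ : ∀ z : ℂ, QSturm.IsSolution q V z (fun x => φ x z))
    (hφ0 : ∀ z : ℂ, QSturm.HasValuesAtZero q (fun x => φ x z)
      ((Real.sqrt q / (1 - q) * Real.sin α : ℝ) : ℂ)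
      ((-(Real.sqrt q / (1 - q) * Real.cos α) : ℝ) : ℂ))
    (hθ : ∀ z : ℂ, QSturm.IsSolution q V z (fun x => θ x z))
    (hθ0 : ∀ z : ℂ, QSturm.HasValuesAtZero q (fun x => θ x z)
      ((Real.sqrt q / (1 - q) * Real.cos α : ℝ) : ℂ)
      ((Real.sqrt q / (1 - q) * Real.sin α : ℝ) : ℂ))
    (m : ℂ → ℂ)
    (hm : ∀ z : ℂ, z.im ≠ 0 →
      m z ∈ QSturm.weylLimit q (fun x => θ x z) (fun x => φ x z))
    (lam : ℕ → ℝ) (hlam : Function.Injective lam)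
    (hanalytic : ∀ z : ℂ, (∀ n, z ≠ (lam n : ℂ)) → AnalyticAt ℂ m z)
    (hpole : ∀ n, meromorphicOrderAt m (lam n : ℂ) < 0)
    (r : ℕ → ℂ) (hr : ∀ n, QSturm.HasResidueAt m (lam n : ℂ) (r n))
    (f : ℝ → ℂ)
    (hf : QSturm.MemDomain q V α (QSturm.weylSolution θ φ m) f) :
    (∀ n, QSturm.JacksonIntegrable q
      (fun y => QSturm.eigenfunction φ lam r n y * f y)) ∧
    (∀ x ∈ QSturm.lattice q, Summable fun n =>
      ‖QSturm.fourierCoef q (QSturm.eigenfunction φ lam r) f n *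
        QSturm.eigenfunction φ lam r n x‖) ∧
    (∀ x ∈ QSturm.lattice q, HasSum
      (fun n => QSturm.fourierCoef q (QSturm.eigenfunction φ lam r) f n *
        QSturm.eigenfunction φ lam r n x) (f x)) ∧
    TendstoUniformlyOn
      (fun (N : ℕ) (x : ℝ) => ∑ n ∈ Finset.range N,
        QSturm.fourierCoef q (QSturm.eigenfunction φ lam r) f n *
          QSturm.eigenfunction φ lam r n x)
      f atTop (QSturm.lattice q) := by
  obtain ⟨hfL2, hLfL2, ⟨a, b, hf0, hbc⟩, hinf⟩ := hf
  have hF := regularFrame_of_solutions (V := V) hq0 hq1 hφ hφ0 hθ hθ0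
  have hW := meromorphicWeyl_of_solutions hq0 hq1 hF hm hlam hanalytic hpole
  set Φ : ℂ → ℤ → ℂ := fun z => scale q fun x => φ x z with hΦ
  set Θ : ℂ → ℤ → ℂ := fun z => scale q fun x => θ x z with hΘ
  have hfm := memℓp_scale hq0 hq1 hfL2
  have hJm : Memℓp (jacobi (offDiag q) (diag q V) (scale q f)) 2 := by
    rw [jacobi_scale hq0 hq1]; exact memℓp_scale hq0 hq1 hLfL2
  set F : SeqL2 := toL2 (scale q f) with hFdef
  set s : ℤ → ℂ := fun k => (Real.sqrt ((1 - q) * q ^ k) : ℂ) with hs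
  have hs0 : ∀ k, s k ≠ 0 := fun k => sqrt_weight_ne_zero hq0 hq1 k
  have hq1' : (1 : ℂ) - q ≠ 0 := by exact_mod_cast (sub_pos.2 hq1).ne'
  have hcoef : ∀ n, pair (MeromorphicWeyl.eigenvec Φ lam n)
      (toL2 (jacobi (offDiag q) (diag q V) (scale q f)))
      = lam n * pair (MeromorphicWeyl.eigenvec Φ lam n) F := by
    refine hW.pair_eigenvec_jacobi hfm hJm (fun z => ?_) (fun z => tendsto_wr_scale hq0 hq1
      (hθ0 z) hf0) (fun z hz => ?_)
    · convert tendsto_wr_scale hq0 hq1 (hφ0 z) hf0 using 2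
      simp only [Complex.ofReal_mul, Complex.ofReal_neg]
      linear_combination -((1 - (q : ℂ)) ^ 2 / q * ((Real.sqrt q / (1 - q) : ℝ) : ℂ)) * hbc
    · refine (hinf z hz).congr fun k => ?_
      rw [hΦ, hΘ, sol_scale, wr_scale_eq_wronskian hq0 hq1]
      rfl
  have hrn : ∀ n, r n = ((‖MeromorphicWeyl.eigenvec Φ lam n‖ ^ 2 : ℝ) : ℂ)⁻¹ := fun n =>
    hW.residue_eq (hr n)
  have hrne : ∀ n, r n ≠ 0 := fun n => by
    rw [hrn]
    simpa using hW.eigenvec_ne_zero n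
  have hterm : ∀ n k, (MeromorphicWeyl.eigenvec Φ lam n : ℤ → ℂ) k * F k
      = (1 - q) * ((q : ℂ) ^ k * (φ (q ^ k) (lam n) * f (q ^ k))) := fun n k => by
    rw [hW.eigenvec_apply, hFdef, toL2_apply hfm]
    have := sqrt_weight_sq hq0 hq1 k
    simp only [hΦ, scale]
    linear_combination φ (q ^ k) (lam n) * f (q ^ k) * this
  have hsum : ∀ n, HasSum (fun k : ℤ => (q : ℂ) ^ k * (eigenfunction φ lam r n (q ^ k) * f (q ^ k)))
      ((1 - q : ℂ)⁻¹ * (r n ^ (1 / 2 : ℂ) * pair (MeromorphicWeyl.eigenvec Φ lam n) F)) :=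
    fun n => by
      refine (((hasSum_pair (MeromorphicWeyl.eigenvec Φ lam n) F).mul_left
        (r n ^ (1 / 2 : ℂ))).mul_left (1 - q : ℂ)⁻¹).congr_fun fun k => ?_
      rw [hterm, eigenfunction]
      field_simp
  have hfc : ∀ n, fourierCoef q (eigenfunction φ lam r) f n
      = r n ^ (1 / 2 : ℂ) * pair (MeromorphicWeyl.eigenvec Φ lam n) F := fun n => by
    rw [fourierCoef, jackson, (hsum n).tsum_eq, mul_inv_cancel_left₀ hq1']
  have hprod : ∀ n k, fourierCoef q (eigenfunction φ lam r) f n * eigenfunction φ lam r n (q ^ k)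
      = (s k)⁻¹ * ((((‖MeromorphicWeyl.eigenvec Φ lam n‖ ^ 2 : ℝ) : ℂ)⁻¹ *
        pair (MeromorphicWeyl.eigenvec Φ lam n) F) * Φ (lam n) k) := fun n k => by
    have hsq : r n ^ (1 / 2 : ℂ) * r n ^ (1 / 2 : ℂ) = r n := by
      rw [← Complex.cpow_add _ _ (hrne n)]; norm_num
    have hsk := hs0 k
    rw [hfc, ← hrn, eigenfunction]
    have hΦk : Φ (lam n) k = s k * φ (q ^ k) (lam n) := rfl
    rw [hΦk]
    field_simp
    linear_combination pair (MeromorphicWeyl.eigenvec Φ lam n) F * φ (q ^ k) (lam n) * hsq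
  have hFk : ∀ k, (s k)⁻¹ * F k = f (q ^ k) := fun k => by
    rw [hFdef, toL2_apply hfm, scale]
    exact inv_mul_cancel_left₀ (hs0 k) _
  have hHS : ∀ x ∈ lattice q, HasSum (fun n => fourierCoef q (eigenfunction φ lam r) f n *
      eigenfunction φ lam r n x) (f x) := by
    rintro x ⟨k, rfl⟩
    have := (hW.hasSum_apply F k).mul_left (s k)⁻¹
    rw [hFk] at this
    exact this.congr_fun fun n => hprod n k
  refine ⟨fun n => ?_, fun x hx => (hHS x hx).summable.norm, hHS, ?_⟩
  · refine (hsum n).summable.norm.congr fun k => ?_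
    rw [norm_mul, norm_zpow, Complex.norm_real, Real.norm_of_nonneg hq0.le]
  -- Green's function at `z = i`, divided by the square root of the weight, is bounded
  have hI : Complex.I ∈ regularSet lam := MeromorphicWeyl.mem_regularSet_of_im_ne (by simp)
  obtain ⟨ε, hε0, hε, hbound⟩ := hW.expansion_bound hcoef hI
  have hψ0 : Tendsto (fun k : ℕ => φ (q ^ k) Complex.I *
      (θ (q ^ k) Complex.I + m Complex.I * φ (q ^ k) Complex.I)) atTop (𝓝 _) :=
    (hφ0 Complex.I).1.mul ((hθ0 Complex.I).1.add ((hφ0 Complex.I).1.const_mul (m Complex.I)))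
  obtain ⟨C, hC⟩ := hψ0.norm.bddAbove_range
  have hsn : ∀ k, ‖s k‖ ^ 2 = (1 - q) * q ^ k := fun k => by
    rw [hs]
    simp only [Complex.norm_real, Real.norm_of_nonneg (Real.sqrt_nonneg _)]
    rw [Real.sq_sqrt (weight_pos hq0 hq1 k).le]
  have hgreen : ∀ k, ‖s k‖⁻¹ * ‖MeromorphicWeyl.green Φ Θ m k Complex.I‖
      ≤ Real.sqrt (max C (1 - q)⁻¹) := by
    intro k
    apply Real.le_sqrt_of_sq_le
    rw [mul_pow, inv_pow, ← div_eq_inv_mul, div_le_iff₀ (by rw [hsn]; exact weight_pos hq0 hq1 k)]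
    rcases le_or_gt 0 k with hk | hk
    · obtain ⟨i, rfl⟩ := Int.eq_ofNat_of_zero_le hk
      have h1 := hW.norm_green_sq_le (z := Complex.I) (by simp) i
      rw [Complex.I_im, abs_one, one_mul] at h1
      have h2 : ‖φ (q ^ i) Complex.I *
        (θ (q ^ i) Complex.I + m Complex.I * φ (q ^ i) Complex.I)‖ ≤ C := hC ⟨i, rfl⟩
      refine h1.trans ?_
      have e : Φ Complex.I i * sol Φ Θ Complex.I (m Complex.I) i = s i ^ 2 *
          (φ (q ^ i) Complex.I * (θ (q ^ i) Complex.I + m Complex.I * φ (q ^ i) Complex.I)) := by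
        simp only [hΦ, hΘ, sol_scale, scale, hs, zpow_natCast]; ring
      rw [e, norm_mul, norm_pow, mul_comm]
      exact mul_le_mul_of_nonneg_right (h2.trans (le_max_left _ _)) (by positivity)
    · have h1 := hW.norm_green_le (z := Complex.I) (by simp) k
      rw [Complex.I_im, abs_one, one_mul] at h1
      have h2 : 1 ≤ q ^ k := one_le_zpow_of_nonpos₀ hq0 hq1.le hk.le
      have h3 : 0 < 1 - q := sub_pos.2 hq1
      calc ‖MeromorphicWeyl.green Φ Θ m k Complex.I‖ ^ 2 ≤ 1 := pow_le_one₀ (norm_nonneg _) h1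
        _ ≤ (1 - q)⁻¹ * ((1 - q) * q ^ k) := by rw [inv_mul_cancel_left₀ h3.ne']; exact h2
        _ ≤ max C (1 - q)⁻¹ * ‖s k‖ ^ 2 := by
          rw [hsn]
          exact mul_le_mul_of_nonneg_right (le_max_right _ _) (weight_pos hq0 hq1 k).le
  rw [Metric.tendstoUniformlyOn_iff]
  intro δ hδ
  have hlim := hε.const_mul (Real.sqrt (max C (1 - q)⁻¹))
  rw [mul_zero] at hlim
  filter_upwards [hlim.eventually (gt_mem_nhds hδ)] with N hN
  rintro x ⟨k, rfl⟩
  refine lt_of_le_of_lt ?_ hN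
  rw [dist_eq_norm, ← hFk k]
  beta_reduce
  rw [Finset.sum_congr rfl fun n _ => hprod n k, ← Finset.mul_sum, ← mul_sub, norm_mul, norm_inv]
  calc ‖s k‖⁻¹ * _ ≤ ‖s k‖⁻¹ * (‖MeromorphicWeyl.green Φ Θ m k Complex.I‖ * ε N) :=
        mul_le_mul_of_nonneg_left (hbound N k) (by positivity)
    _ = (‖s k‖⁻¹ * ‖MeromorphicWeyl.green Φ Θ m k Complex.I‖) * ε N := by ring
    _ ≤ _ := mul_le_mul_of_nonneg_right (hgreen k) (hε0 N)
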